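/- **Theorem (discrete exponential stability).** Let $\Omega\subset\mathbb{R}^d$, $d\le 3$, be a bounded convex domain, let $\nu>0$, $R\ge 0$, $\varphi(y)=y^3-y$, and let $H_n^2=\{v\in H^2(\Omega):\partial_n v=0 \text{ on }\partial\Omega\}$ with the norm of $H^2(\Omega)$ and dual space $H_n^{-2}$. Write $\langle\cdot,\cdot\rangle$ for the $L^2(\Omega)$ inner product and for the duality pairing, and $\|\cdot\|$ for the norm of $L^2(\Omega)$. Let $\mathcal F:H_n^2\to H_n^{-2}$ be linear and continuous with $\langle\mathcal F z,z\rangle\ge 0$ for all $z\in H_n^2$, and suppose that for some $\gamma>0$ the spectral condition $$\nu\|\Delta z\|^2+2\langle\mathcal F z,z\rangle\ \ge\ (C^*+\gamma)\|z\|^2\qquad\text{for all } z\in H_n^2$$ holds, where $C^*=\tfrac32\big(R^2+(3R^2)^{4/3}\nu^{-1/3}+\nu^{-1}\big)+1$. Let $\tau>0$, $t^n=n\tau$, $d_\tau a^n=\frac1\tau(a^n-a^{n-1})$, let $V_h\subset H_n^2$ be a finite-dimensional subspace, and let $(h^n)_{n\ge0}$, $(h_r^n)_{n\ge 0}$ be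 sequences in $L^2(\Omega)$. Let $(y_{r,h}^n)_{n\ge0}\subset V_h$ satisfy $\|y_{r,h}^n\|_{W^{1,\infty}(\Omega)}=\max\{\|y_{r,h}^n\|_{L^\infty},\||\nabla y_{r,h}^n|\|_{L^\infty}\}\le R$ for all $n\ge0$ and $$\langle d_\tau y_{r,h}^n,v_h\rangle+\nu\langle\Delta y_{r,h}^n,\Delta v_h\rangle-\langle\varphi(y_{r,h}^n),\Delta v_h\rangle=\langle h_r^n,v_h\rangle\qquad\text{for all } v_h\in V_h,\ n\ge1 .$$ Then every sequence $(y_h^n)_{n\ge0}\subset V_h$ with $$\langle d_\tau y_h^n,v_h\rangle+\nu\langle\Delta y_h^n,\Delta v_h\rangle=\langle\varphi(y_h^n),\Delta v_h\rangle+\langle h^n,v_h\rangle-\langle\mathcal F(y_h^n-y_{r,h}^n),v_h\rangle\qquad\text{for all } v_h\in V_h,\ n\ge1,$$ satisfies, for all $n\ge 0$, $$\|y_h^n-y_{r,h}^n\|^2\ \le\ e^{-\tilde\gamma t^n}\|y_h^0-y_{r,h}^0\|^2+\sum_{k=0}^n\tau\, e^{-\tilde\gamma(t^n-t^k)}\|h^k-h_r^k\|^2,$$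 where $\tilde\gamma$ is defined by $\tau\tilde\gamma=\log(1+\tau\gamma)$. In particular, if $h^n=h_r^n$ for all $n\ge1$, then $\|y_h^n-y_{r,h}^n\|^2\le e^{-\tilde\gamma t^n}\|y_h^0-y_{r,h}^0\|^2$ for all $n\ge0$. The decay is uniform in the discretisation parameters: $\tilde\gamma=\tilde\gamma(\tau)>0$ depends only on $\gamma$ and $\tau$, it is non-increasing in $\tau$ (so $\tilde\gamma(\tau)\ge\tilde\gamma(\tau_0)>0$ for $0<\tau\le\tau_0$), and $\tilde\gamma(\tau)\to\gamma$ as $\tau\to0^+$. -/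

import Mathlib

open MeasureTheory Filter Topology
open scoped ENNReal ContDiff

noncomputable section

namespace CahnHilliard

variable {d : ℕ}

/-- The real Lebesgue space `L²(Ω)` of a set `Ω ⊆ ℝᵈ`. -/
abbrev L2 (Ω : Set (EuclideanSpace ℝ (Fin d))) : Type :=
  Lp ℝ 2 (volume.restrict Ω)

/-- `g` is the weak (distributional) partial derivative `∂ᵢ f` on `Ω`. -/
def HasWeakPartial (Ω : Set (EuclideanSpace ℝ (Fin d))) (i : Fin d) (f g : L2 Ω) : Prop :=
  ∀ θ : EuclideanSpace ℝ (Fin d) → ℝ, ContDiff ℝ ∞ θ → HasCompactSupport θ → tsupport θ ⊆ Ω →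
    ∫ x in Ω, f x * fderiv ℝ θ x (EuclideanSpace.single i 1) = - ∫ x in Ω, g x * θ x

/-- Families `(u, (pᵢ)ᵢ, (qᵢⱼ)ᵢⱼ)` of functions in `L²(Ω)`, with the Hilbert norm
`(‖u‖² + ∑ ‖pᵢ‖² + ∑ ‖qᵢⱼ‖²)^(1/2)`; on the families of weak derivatives of order at most two this
is the norm of `H²(Ω)`. -/
abbrev Jet (Ω : Set (EuclideanSpace ℝ (Fin d))) : Type :=
  PiLp 2 (fun _ : Unit ⊕ (Fin d ⊕ (Fin d × Fin d)) => L2 Ω)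

namespace Jet

variable {Ω : Set (EuclideanSpace ℝ (Fin d))}

/-- The function itself. -/
def val (u : Jet Ω) : L2 Ω := u (Sum.inl ())

/-- The first order component `∂ᵢ u`. -/
def grad (u : Jet Ω) (i : Fin d) : L2 Ω := u (Sum.inr (Sum.inl i))

/-- The second order component `∂ⱼ ∂ᵢ u`. -/
def hess (u : Jet Ω) (i j : Fin d) : L2 Ω := u (Sum.inr (Sum.inr (i, j)))

/-- The Laplacian `Δ u`. -/
def lap (u : Jet Ω) : L2 Ω := ∑ i, hess u i i

end Jet

section closure

variable {Ω : Set (EuclideanSpace ℝ (Fin d))} {i : Fin d}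

lemma integrable_mul_test (f : L2 Ω) {θ : EuclideanSpace ℝ (Fin d) → ℝ} (hc : Continuous θ)
    (hs : HasCompactSupport θ) : Integrable (fun x => f x * θ x) (volume.restrict Ω) :=
  (Lp.memLp f).integrable_mul
    ((hc.memLp_of_hasCompactSupport (μ := volume) (p := 2) hs).restrict Ω)

lemma integrable_mul_fderiv_test (f : L2 Ω) {θ : EuclideanSpace ℝ (Fin d) → ℝ}
    (hc : ContDiff ℝ ∞ θ) (hs : HasCompactSupport θ) (e : EuclideanSpace ℝ (Fin d)) :
    Integrable (fun x => f x * fderiv ℝ θ x e) (volume.restrict Ω) :=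
  integrable_mul_test f ((hc.continuous_fderiv (by simp)).clm_apply continuous_const)
    (hs.fderiv_apply (𝕜 := ℝ) e)

lemma HasWeakPartial.zero : HasWeakPartial Ω i 0 0 := by
  intro θ _ _ _
  have h : ∀ k : EuclideanSpace ℝ (Fin d) → ℝ,
      ∫ x in Ω, (0 : L2 Ω) x * k x = 0 := by
    intro k
    refine integral_eq_zero_of_ae ?_
    filter_upwards [Lp.coeFn_zero ℝ 2 (volume.restrict Ω)] with x hx
    rw [hx, Pi.zero_apply, zero_mul]
  rw [h, h, neg_zero]

lemma HasWeakPartial.add {f g f' g' : L2 Ω} (h : HasWeakPartial Ω i f g)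
    (h' : HasWeakPartial Ω i f' g') : HasWeakPartial Ω i (f + f') (g + g') := by
  intro θ h1 h2 h3
  have key : ∀ (a b : L2 Ω) (k : EuclideanSpace ℝ (Fin d) → ℝ),
      Integrable (fun x => a x * k x) (volume.restrict Ω) →
      Integrable (fun x => b x * k x) (volume.restrict Ω) →
      ∫ x in Ω, (a + b : L2 Ω) x * k x = (∫ x in Ω, a x * k x) + ∫ x in Ω, b x * k x := by
    intro a b k ha hb
    rw [← integral_add ha hb]
    refine integral_congr_ae ?_
    filter_upwards [Lp.coeFn_add a b] with x hx
    rw [hx, Pi.add_apply, add_mul]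
  rw [key _ _ _ (integrable_mul_fderiv_test f h1 h2 _) (integrable_mul_fderiv_test f' h1 h2 _),
    key _ _ _ (integrable_mul_test g h1.continuous h2) (integrable_mul_test g' h1.continuous h2),
    h θ h1 h2 h3, h' θ h1 h2 h3]
  ring

lemma HasWeakPartial.smul {f g : L2 Ω} (c : ℝ) (h : HasWeakPartial Ω i f g) :
    HasWeakPartial Ω i (c • f) (c • g) := by
  intro θ h1 h2 h3
  have key : ∀ (a : L2 Ω) (k : EuclideanSpace ℝ (Fin d) → ℝ),
      ∫ x in Ω, (c • a : L2 Ω) x * k x = c * ∫ x in Ω, a x * k x := by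
    intro a k
    rw [← integral_const_mul]
    refine integral_congr_ae ?_
    filter_upwards [Lp.coeFn_smul c a] with x hx
    rw [hx, Pi.smul_apply, smul_eq_mul, mul_assoc]
  rw [key, key, h θ h1 h2 h3, mul_neg]

end closure

/-- The space `H²ₙ(Ω) = {u ∈ H²(Ω) : ∂ₙ u = 0 on ∂Ω}` with the norm of `H²(Ω)`. A function is
stored together with its weak derivatives of order at most two, which it determines. The boundary
condition is expressed by Green's formula `∫ ∇u · ∇w = - ∫ Δu w` for all `w ∈ H¹(Ω)`. -/
def H2n (Ω : Set (EuclideanSpace ℝ (Fin d))) : Submodule ℝ (Jet Ω) where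
  carrier := {u |
    (∀ i, HasWeakPartial Ω i u.val (u.grad i)) ∧
    (∀ i j, HasWeakPartial Ω j (u.grad i) (u.hess i j)) ∧
    ∀ (w : L2 Ω) (p : Fin d → L2 Ω), (∀ i, HasWeakPartial Ω i w (p i)) →
      ∑ i, inner ℝ (u.grad i) (p i) = - inner ℝ u.lap w}
  zero_mem' := by
    refine ⟨fun i => HasWeakPartial.zero, fun i j => HasWeakPartial.zero, fun w p _ => ?_⟩
    simp [Jet.grad, Jet.lap, Jet.hess]
  add_mem' := by
    rintro u v ⟨hu1, hu2, hu3⟩ ⟨hv1, hv2, hv3⟩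
    refine ⟨fun i => (hu1 i).add (hv1 i), fun i j => (hu2 i j).add (hv2 i j), fun w p hp => ?_⟩
    have h1 := hu3 w p hp
    have h2 := hv3 w p hp
    simp only [Jet.grad, Jet.lap, Jet.hess, PiLp.add_apply, inner_add_left,
      Finset.sum_add_distrib] at h1 h2 ⊢
    rw [h1, h2]
    ring
  smul_mem' := by
    rintro c u ⟨hu1, hu2, hu3⟩
    refine ⟨fun i => (hu1 i).smul c, fun i j => (hu2 i j).smul c, fun w p hp => ?_⟩
    have h1 := hu3 w p hp
    simp only [Jet.grad, Jet.lap, Jet.hess, PiLp.smul_apply, real_inner_smul_left,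
      ← Finset.smul_sum, ← Finset.mul_sum] at h1 ⊢
    rw [h1]
    ring

section scheme

variable {Ω : Set (EuclideanSpace ℝ (Fin d))}

/-- The norm of `W^{1,∞}(Ω)`: the larger one of the essential suprema of `|u|` and of the Euclidean
length `|∇u|`. -/
def w1InftyNorm (u : Jet Ω) : ℝ≥0∞ :=
  max (eLpNorm (fun x => u.val x) ∞ (volume.restrict Ω))
    (eLpNorm (fun x => √(∑ i, (u.grad i x) ^ 2)) ∞ (volume.restrict Ω))

/-- The nonlinearity `φ(y) = y³ - y`. -/
def phi (s : ℝ) : ℝ := s ^ 3 - s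

/-- The constant `C* = 3/2 (R² + (3R²)^{4/3} ν^{-1/3} + ν^{-1}) + 1`. -/
def Cstar (ν R : ℝ) : ℝ :=
  3 / 2 * (R ^ 2 + (3 * R ^ 2) ^ (4 / 3 : ℝ) * ν ^ (-1 / 3 : ℝ) + ν⁻¹) + 1

/-- The spectral condition
`ν ‖Δz‖² + 2 ⟨F z, z⟩ ≥ (C* + γ) ‖z‖²` for all `z ∈ H²ₙ(Ω)`, with norms in `L²(Ω)`. -/
def SpectralCondition (ν R γ : ℝ) (F : H2n Ω →L[ℝ] StrongDual ℝ (H2n Ω)) : Prop :=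
  ∀ z : H2n Ω,
    (Cstar ν R + γ) * ‖z.1.val‖ ^ 2 ≤ ν * ‖z.1.lap‖ ^ 2 + 2 * F z z

/-- `⟨d_τ y, v⟩ + ⟨ν Δy, Δv⟩ - ⟨φ(y), Δv⟩ = r v` for all `v ∈ V`, where `d_τ y = (y - y') / τ` and
`y'` is the value at the previous time. The pairing `⟨φ(y), Δv⟩ = ∫ φ(y) Δv` is required to exist
as an integral; since `H²(Ω) ⊆ L^∞(Ω)` on bounded convex domains of dimension at most three, it
always does. -/
def EulerStep (ν τ : ℝ) (V : Submodule ℝ (H2n Ω)) (y' y : H2n Ω) (r : H2n Ω → ℝ) : Prop :=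
  ∀ v ∈ V,
    Integrable (fun x => phi (y.1.val x) * v.1.lap x) (volume.restrict Ω) ∧
    inner ℝ (τ⁻¹ • (y.1.val - y'.1.val)) v.1.val + ν * inner ℝ y.1.lap v.1.lap
      - (∫ x in Ω, phi (y.1.val x) * v.1.lap x) = r v

/-- `(yr n)` is a discrete target trajectory in `V` with right hand side `(hr n)`. -/
def IsDiscreteTarget (ν τ : ℝ) (V : Submodule ℝ (H2n Ω)) (hr : ℕ → L2 Ω) (yr : ℕ → H2n Ω) :
    Prop :=
  (∀ n, yr n ∈ V) ∧
  ∀ n, EulerStep ν τ V (yr n) (yr (n + 1)) (fun v => inner ℝ (hr (n + 1)) v.1.val)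

/-- `(y n)` is a solution in `V` of the implicit Euler Galerkin scheme with forcing `(h n)` and
feedback `-F (y - yr)`. -/
def IsDiscreteSolution (ν τ : ℝ) (F : H2n Ω →L[ℝ] StrongDual ℝ (H2n Ω))
    (V : Submodule ℝ (H2n Ω)) (yr : ℕ → H2n Ω) (h : ℕ → L2 Ω) (y : ℕ → H2n Ω) : Prop :=
  (∀ n, y n ∈ V) ∧
  ∀ n, EulerStep ν τ V (y n) (y (n + 1))
    (fun v => inner ℝ (h (n + 1)) v.1.val - F (y (n + 1) - yr (n + 1)) v)

end scheme

/-- The discrete decay rate `γ̃`, defined by `τ γ̃ = log (1 + τ γ)`. -/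
def discreteRate (γ τ : ℝ) : ℝ := Real.log (1 + τ * γ) / τ

end CahnHilliard

end

/-! Test the difference of the two schemes with u = y - yr. The only delicate term is 2∫(φ(y) -
φ(yr))Δu, which `nonlinear_term_le` bounds by ν‖Δu‖² + (C* - 1)‖u‖². Young's inequality for the
forcing uses up the remaining 1 in C*, and the spectral condition then turns the energy identity
into a recursion with factor 1 + τγ (`energy_step`). Since 1 + τγ = exp(τγ̃), `gronwall_step`
iterates it to the claim.

The nonlinear bound is a calibration argument. For a function e(z, ρ), Green's formula says that ∫
e(u, yr)Δu + ∫ (e_z |∇u|² + e_ρ ∇yr·∇u) = 0, so this quantity can be subtracted for free. With e =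
2((ρ + z)³ - ρ³) + zA the cubic terms in front of Δu cancel. What remains is -(2z + zA)Δu, absorbed
by ν|Δu|² at the price (2z + zA)²/(4ν), and a quadratic polynomial in p = |∇u| with leading
coefficient -e_z, whose linear term is controlled by |∇yr| ≤ R. Everything reduces to a scalar
inequality in z, ρ, p, which `exists_calibration` solves by choosing A in one of two shapes.

Green's formula for e(u, yr) has to be justified without a bound on u. The weak chain rule
`HasWeakPartial.comp₂` and the Neumann condition give it for bounded functions (`green_of_bounded`).
The integrability of φ(y)Δu contained in `EulerStep` makes u³Δu integrable, hence also u²|∇u|²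
(`integrable_sq_mul_gradDot`), and truncation extends the formula to cubic growth
(`green_of_cubic_growth`). -/

namespace CahnHilliard

/-! ### The calibration and its pointwise inequality -/

/-- The calibration `e(z, ρ) = 2 ((ρ + z)³ - ρ³) + z (a + b ρ² + c z² / (q + z²))`. -/
noncomputable def calib (a b c q z ρ : ℝ) : ℝ :=
  2 * ((ρ + z) ^ 3 - ρ ^ 3) + z * (a + b * ρ ^ 2 + c * (z ^ 2 / (q + z ^ 2)))

/-- The partial derivative of `calib` in `z`. -/
noncomputable def calibZ (a b c q z ρ : ℝ) : ℝ :=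
  6 * (ρ + z) ^ 2 + (a + b * ρ ^ 2 + c * (z ^ 2 * (3 * q + z ^ 2) / (q + z ^ 2) ^ 2))

/-- The partial derivative of `calib` in `ρ`. -/
noncomputable def calibR (b z ρ : ℝ) : ℝ :=
  6 * z * (2 * ρ + z) + 2 * b * ρ * z

/-- Completing the square in `p`. -/
lemma linear_sub_quadratic_le {α β p D : ℝ} (hα : 0 < α) (h : β ^ 2 ≤ 4 * α * D) :
    β * p - α * p ^ 2 ≤ D := by
  have h2 : α * (β * p - α * p ^ 2) ≤ α * D := by nlinarith [sq_nonneg (2 * α * p - β)]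
  exact le_of_mul_le_mul_left h2 hα

/-- The regime R² ≤ M. Here A = M + 6κ(R² - ρ²) with κ = 17/250. The ρ-dependence weakens e_ρ, while
A stays at least M and exceeds it only where |ρ| < R, so that ρ² in the cross term is below its
maximum. -/
lemma pointwise_bound_of_sq_le {ν R M z ρ p : ℝ} (hν : 0 < ν) (hR : 0 ≤ R) (hM : 0 ≤ M)
    (hMR : M ^ 3 = 9 * R ^ 4 * ν) (hle : R ^ 2 ≤ M) (hρ : |ρ| ≤ R) :
    (2 * z + z * (M + 6 * (17 / 250) * R ^ 2 + (-(6 * (17 / 250))) * ρ ^ 2)) ^ 2 / (4 * ν)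
      - (6 * (ρ + z) ^ 2 + (M + 6 * (17 / 250) * R ^ 2 + (-(6 * (17 / 250))) * ρ ^ 2)) * p ^ 2
      + |calibR (-(6 * (17 / 250))) z ρ| * R * p
      ≤ 3 / 2 * (R ^ 2 + (M ^ 2 + 1) / ν) * z ^ 2 := by
  have hρ2 : ρ ^ 2 ≤ R ^ 2 := sq_le_sq' (abs_le.1 hρ).1 (abs_le.1 hρ).2
  -- For R = 0 also M = ρ = 0, and the divisions by D and R² below lose their meaning.
  rcases hR.eq_or_lt with rfl | hR
  · have hM0 : M = 0 := by
      have : M ^ 3 = 0 := by rw [hMR]; ring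
      exact pow_eq_zero_iff (by norm_num) |>.1 this
    have hρ0 : ρ = 0 := by nlinarith
    subst hM0 hρ0
    have h1 : (2 * z) ^ 2 / (4 * ν) = ν⁻¹ * z ^ 2 := by field_simp; ring
    have h2 : 0 ≤ ν⁻¹ * z ^ 2 := by positivity
    have h3 : 0 ≤ (z * p) ^ 2 := sq_nonneg _
    simp only [div_eq_mul_inv] at *
    nlinarith
  have hMpos : 0 < M := by
    have : 0 < M ^ 3 := by rw [hMR]; positivity
    exact lt_of_le_of_ne hM (fun h => by rw [← h] at this; norm_num at this)
  set D : ℝ := M + 6 * (17 / 250) * R ^ 2 + (-(6 * (17 / 250))) * ρ ^ 2 with hD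
  have hDM : M ≤ D := by rw [hD]; nlinarith
  have hDpos : 0 < D := hMpos.trans_le hDM
  -- The factor 108/125 is 1 - 2κ.
  have hcal : calibR (-(6 * (17 / 250))) z ρ = 6 * z * ((ρ + z) + 108 / 125 * ρ) := by
    unfold calibR; ring
  -- the scaled inequality
  have key : (2 + D) ^ 2 / 4 + 9 * R ^ 2 * ν * (108 / 125) ^ 2 * ρ ^ 2 / D
      ≤ 3 / 2 * (M ^ 2 + 1) := by
    set w : ℝ := ρ ^ 2 / R ^ 2 with hw
    have hw0 : 0 ≤ w := by positivity
    have hw1 : w ≤ 1 := (div_le_one (by positivity)).2 hρ2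
    have hwρ : ρ ^ 2 = w * R ^ 2 := by rw [hw]; field_simp
    have hD2 : D ≤ M * (1 + 6 * (17 / 250) * (1 - w)) := by
      rw [hD, hwρ]; nlinarith [mul_le_mul_of_nonneg_right hle (sub_nonneg.2 hw1)]
    have h1 : 9 * R ^ 2 * ν * (108 / 125) ^ 2 * ρ ^ 2 / D ≤ M ^ 2 * (108 / 125) ^ 2 * w := by
      rw [div_le_iff₀ hDpos, hwρ]
      have : 9 * R ^ 2 * ν * (108 / 125) ^ 2 * (w * R ^ 2) = M ^ 2 * (108 / 125) ^ 2 * w * M := by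
        linear_combination (-(108 / 125) ^ 2 * w) * hMR
      rw [this]
      exact mul_le_mul_of_nonneg_left hDM (by positivity)
    have h2 : (2 + D) ^ 2 ≤ (2 + M * (1 + 6 * (17 / 250) * (1 - w))) ^ 2 :=
      pow_le_pow_left₀ (by linarith) (by linarith) 2
    -- By convexity in w (`hconv`) only w = 0 and w = 1 matter. As quadratics in M the two endpoint
    -- inequalities have nonpositive discriminant exactly when (1 + 6κ)² ≤ 2 and (1 - 2κ)² ≤ 3/4.
    -- This leaves a window of roughly 0.0670 ≤ κ ≤ 0.0690, whence κ = 17/250.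
    have e0 : (2 + M * (1 + 6 * (17 / 250))) ^ 2 / 4 ≤ 3 / 2 * (M ^ 2 + 1) := by
      nlinarith [sq_nonneg (M - 701 / 1000)]
    have e1 : (2 + M) ^ 2 / 4 + M ^ 2 * (108 / 125) ^ 2 ≤ 3 / 2 * (M ^ 2 + 1) := by
      nlinarith [sq_nonneg (M - 1)]
    have hconv : (2 + M * (1 + 6 * (17 / 250) * (1 - w))) ^ 2
        ≤ (1 - w) * (2 + M * (1 + 6 * (17 / 250))) ^ 2 + w * (2 + M) ^ 2 := by
      nlinarith [mul_nonneg (mul_nonneg hw0 (sub_nonneg.2 hw1)) (sq_nonneg M)]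
    nlinarith [mul_le_mul_of_nonneg_left e0 (sub_nonneg.2 hw1), mul_le_mul_of_nonneg_left e1 hw0]
  have hsplit : |calibR (-(6 * (17 / 250))) z ρ| * R * p - (6 * (ρ + z) ^ 2 + D) * p ^ 2
      ≤ 3 / 2 * R ^ 2 * z ^ 2 + 9 * R ^ 2 * (108 / 125) ^ 2 * ρ ^ 2 / D * z ^ 2 := by
    apply linear_sub_quadratic_le (by positivity)
    rw [hcal, mul_pow, sq_abs]
    have hx : (3 / 2 * R ^ 2 * z ^ 2 + 9 * R ^ 2 * (108 / 125) ^ 2 * ρ ^ 2 / D * z ^ 2)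
        = R ^ 2 * z ^ 2 * (3 / 2 + 9 * (108 / 125 * ρ) ^ 2 / D) := by field_simp
    rw [hx]
    -- Cauchy–Schwarz with weights 6 and D; the weight 6 produces exactly the term 3/2 R² of C*.
    have hcs : 36 * ((ρ + z) + 108 / 125 * ρ) ^ 2
        ≤ 4 * (6 * (ρ + z) ^ 2 + D) * (3 / 2 + 9 * (108 / 125 * ρ) ^ 2 / D) := by
      set c : ℝ := 108 / 125 * ρ
      set y : ℝ := ρ + z
      have : 4 * (6 * y ^ 2 + D) * (3 / 2 + 9 * c ^ 2 / D) - 36 * (y + c) ^ 2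
          = 6 / D * (D - 6 * y * c) ^ 2 := by field_simp; ring
      have h0 : 0 ≤ 6 / D * (D - 6 * y * c) ^ 2 := by positivity
      linarith
    calc (6 * z * ((ρ + z) + 108 / 125 * ρ)) ^ 2 * R ^ 2
        = R ^ 2 * z ^ 2 * (36 * ((ρ + z) + 108 / 125 * ρ) ^ 2) := by ring
      _ ≤ R ^ 2 * z ^ 2 * (4 * (6 * (ρ + z) ^ 2 + D) * (3 / 2 + 9 * (108 / 125 * ρ) ^ 2 / D)) :=
          mul_le_mul_of_nonneg_left hcs (by positivity)
      _ = _ := by ring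
  have hkz := mul_le_mul_of_nonneg_right key (show 0 ≤ z ^ 2 / ν by positivity)
  have e1 : (2 * z + z * D) ^ 2 / (4 * ν) + 9 * R ^ 2 * (108 / 125) ^ 2 * ρ ^ 2 / D * z ^ 2
      = ((2 + D) ^ 2 / 4 + 9 * R ^ 2 * ν * (108 / 125) ^ 2 * ρ ^ 2 / D) * (z ^ 2 / ν) := by
    field_simp
  have e2 : 3 / 2 * (M ^ 2 + 1) * (z ^ 2 / ν) = 3 / 2 * ((M ^ 2 + 1) / ν) * z ^ 2 := by
    field_simp
  linarith

/-- The discriminant condition of the regime M < R², scaled by R, with l = M/R². Because l(2P + Z)²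
= l(3P² + 2PZ) + l(P + Z)², the summand l/6 absorbs the second part. Cauchy–Schwarz settles the rest
where Ah·B ≥ 1, which fails for s near 0 and near 1; those ends are treated by hand. -/
lemma normalized_bound {Z P l s : ℝ} (hP : |P| ≤ 1) (hl : 0 < l) (hl1 : l ≤ 1)
    (hs : s = Z ^ 2 / (1 + Z ^ 2)) :
    l * (2 * P + Z) ^ 2 ≤ (6 * (P + Z) ^ 2 + l * (2 / 5 + 12 / 5 * s - 8 / 5 * s ^ 2))
      * (3 / 2 - 3 / 4 * (2 / 5 + 4 / 5 * s) ^ 2 + l / 6) := by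
  have hP2 : P ^ 2 ≤ 1 := by nlinarith [abs_le.1 hP]
  have hs0 : 0 ≤ s := by rw [hs]; positivity
  have hs1 : s ≤ 1 := by rw [hs, div_le_one (by positivity)]; linarith
  have hsZ : s * (1 + Z ^ 2) = Z ^ 2 := by rw [hs]; field_simp
  set Ah : ℝ := 2 / 5 + 12 / 5 * s - 8 / 5 * s ^ 2 with hAh
  set B : ℝ := 3 / 2 - 3 / 4 * (2 / 5 + 4 / 5 * s) ^ 2 with hB
  have hA0 : 2 / 5 ≤ Ah := by rw [hAh]; nlinarith
  have hB0 : 21 / 50 ≤ B := by rw [hB]; nlinarith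
  rcases le_total s (1 / 5) with h | h
  -- For small Z the form 3P² + 2PZ is positive only away from P = -Z, so 6(P + Z)² and the constant
  -- 2/5 dominate it.
  · have hZ : Z ^ 2 ≤ 1 / 4 := by nlinarith [sq_nonneg Z]
    have hB1 : 63 / 50 ≤ B := by rw [hB]; nlinarith
    have q1 : 3 * P ^ 2 + 2 * P * Z ≤ 63 / 50 * (6 * (P + Z) ^ 2 + 2 / 5) := by
      nlinarith [sq_nonneg (P + 13.12 / 9.12 * Z)]
    have q2 : 63 / 50 * (6 * l * (P + Z) ^ 2 + l * (2 / 5)) ≤ B * (6 * (P + Z) ^ 2 + l * Ah) := by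
      have : 6 * l * (P + Z) ^ 2 + l * (2 / 5) ≤ 6 * (P + Z) ^ 2 + l * Ah := by
        nlinarith [mul_le_mul_of_nonneg_right hl1 (sq_nonneg (P + Z)),
          mul_le_mul_of_nonneg_left hA0 hl.le]
      exact mul_le_mul hB1 this (by positivity) (by linarith)
    have q3 := mul_le_mul_of_nonneg_left q1 hl.le
    have q4 : 0 ≤ l * Ah * (l / 6) := by positivity
    have q5 : l * (2 * P + Z) ^ 2 = l * (3 * P ^ 2 + 2 * P * Z) + l * (P + Z) ^ 2 := by ring
    have q6 : (6 * (P + Z) ^ 2 + l * Ah) * (B + l / 6)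
        = B * (6 * (P + Z) ^ 2 + l * Ah) + l * (P + Z) ^ 2 + l * Ah * (l / 6) := by ring
    have q7 : l * (63 / 50 * (6 * (P + Z) ^ 2 + 2 / 5))
        = 63 / 50 * (6 * l * (P + Z) ^ 2 + l * (2 / 5)) := by ring
    linarith
  rcases le_total s (9 / 13) with h' | h'
  · have hAB : 1 ≤ Ah * B := by
      rw [hAh, hB]
      have h1 : 0 ≤ (s - 1 / 5) * (9 / 13 - s) :=
        mul_nonneg (sub_nonneg.2 h) (sub_nonneg.2 h')
      nlinarith [mul_nonneg h1 hs0, mul_nonneg h1 (sq_nonneg s)]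
    have hApos : 0 < Ah := by linarith
    have hBA : 1 / Ah ≤ B := by rw [div_le_iff₀ hApos]; linarith
    have q1 : (6 * (P + Z) ^ 2 + l * Ah) * (1 / Ah + l / 6) - l * (2 * P + Z) ^ 2
        = 6 / Ah * ((P + Z) - l * Ah * P / 6) ^ 2 + (1 - P ^ 2) * (l + l ^ 2 * Ah / 6) := by
      field_simp; ring
    have q2 : 0 ≤ 6 / Ah * ((P + Z) - l * Ah * P / 6) ^ 2
        + (1 - P ^ 2) * (l + l ^ 2 * Ah / 6) :=
      add_nonneg (by positivity) (mul_nonneg (by linarith) (by positivity))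
    have q3 : (6 * (P + Z) ^ 2 + l * Ah) * (1 / Ah + l / 6)
        ≤ (6 * (P + Z) ^ 2 + l * Ah) * (B + l / 6) :=
      mul_le_mul_of_nonneg_left (by linarith) (by positivity)
    linarith
  -- For large Z, 2P² ≤ 2 ≤ Z² keeps P + Z away from zero, and 6B ≥ 1 suffices.
  · have hZ : 9 / 4 ≤ Z ^ 2 := by nlinarith [sq_nonneg Z]
    have q0 : 3 * P ^ 2 + 2 * P * Z ≤ (P + Z) ^ 2 := by linarith [add_sq P Z]
    have q1 : l * (3 * P ^ 2 + 2 * P * Z) ≤ 6 * (P + Z) ^ 2 * B := by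
      calc l * (3 * P ^ 2 + 2 * P * Z) ≤ l * (P + Z) ^ 2 := mul_le_mul_of_nonneg_left q0 hl.le
        _ ≤ (6 * B) * (P + Z) ^ 2 := mul_le_mul_of_nonneg_right (by linarith) (sq_nonneg _)
        _ = 6 * (P + Z) ^ 2 * B := by ring
    have q2 : 0 ≤ l * Ah * (B + l / 6) :=
      mul_nonneg (mul_nonneg hl.le (by linarith)) (by linarith)
    have q3 : l * (2 * P + Z) ^ 2 = l * (3 * P ^ 2 + 2 * P * Z) + l * (P + Z) ^ 2 := by ring
    have q4 : (6 * (P + Z) ^ 2 + l * Ah) * (B + l / 6)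
        = 6 * (P + Z) ^ 2 * B + l * (P + Z) ^ 2 + l * Ah * (B + l / 6) := by ring
    linarith

/-- The regime M < R². The coefficient A is independent of ρ and rises with |z| from 2M/5 towards
6M/5 on the scale R. In the proof it is written M·A, and Ah is its counterpart in e_z, from the
derivative of z·A. -/
lemma pointwise_bound_of_lt_sq {ν R M z ρ p : ℝ} (hν : 0 < ν) (hR : 0 ≤ R) (hM : 0 ≤ M)
    (hMR : M ^ 3 = 9 * R ^ 4 * ν) (hlt : M < R ^ 2) (hρ : |ρ| ≤ R) :
    (2 * z + z * (2 / 5 * M + 4 / 5 * M * (z ^ 2 / (R ^ 2 + z ^ 2)))) ^ 2 / (4 * ν)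
      - (6 * (ρ + z) ^ 2 + (2 / 5 * M
        + 4 / 5 * M * (z ^ 2 * (3 * R ^ 2 + z ^ 2) / (R ^ 2 + z ^ 2) ^ 2))) * p ^ 2
      + |calibR 0 z ρ| * R * p
      ≤ 3 / 2 * (R ^ 2 + (M ^ 2 + 1) / ν) * z ^ 2 := by
  have hR : 0 < R := by
    rcases hR.eq_or_lt with rfl | hR
    · norm_num at hlt; linarith
    · exact hR
  have hMpos : 0 < M := by
    have : 0 < M ^ 3 := by rw [hMR]; positivity
    exact lt_of_le_of_ne hM (fun h => by rw [← h] at this; norm_num at this)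
  set s : ℝ := z ^ 2 / (R ^ 2 + z ^ 2) with hs
  have hs' : s = (z / R) ^ 2 / (1 + (z / R) ^ 2) := by rw [hs]; field_simp
  have hAh : 4 / 5 * M * (z ^ 2 * (3 * R ^ 2 + z ^ 2) / (R ^ 2 + z ^ 2) ^ 2)
      = M * (12 / 5 * s - 8 / 5 * s ^ 2) := by
    rw [hs]; field_simp; ring
  have hs0 : 0 ≤ s := by rw [hs]; positivity
  have hs1 : s ≤ 1 := by rw [hs, div_le_one (by positivity)]; nlinarith
  have hnb := normalized_bound (Z := z / R) (P := ρ / R) (l := M / R ^ 2) (s := s)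
    (by rw [abs_div, abs_of_pos hR, div_le_one hR]; exact hρ) (by positivity)
    ((div_le_one (by positivity)).2 hlt.le) hs'
  set A : ℝ := 2 / 5 + 4 / 5 * s with hA
  set Ah : ℝ := 2 / 5 + 12 / 5 * s - 8 / 5 * s ^ 2 with hAhd
  have hAh0 : 0 < Ah := by rw [hAhd]; nlinarith
  have hcal : calibR 0 z ρ = 6 * z * (2 * ρ + z) := by unfold calibR; ring
  -- The largest B for which (2 + MA)²/4 + BM² ≤ 3/2 (M² + 1) holds for all M: the gap in `key` is
  -- then a perfect square.
  set B : ℝ := 3 / 2 - 3 / 4 * A ^ 2 with hB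
  have e0 : (2 / 5 * M + 4 / 5 * M * (z ^ 2 * (3 * R ^ 2 + z ^ 2) / (R ^ 2 + z ^ 2) ^ 2))
      = M * Ah := by rw [hAh, hAhd]; ring
  have e1 : 2 / 5 * M + 4 / 5 * M * s = M * A := by rw [hA]; ring
  rw [e0, e1]
  have hnb' : M * (2 * ρ + z) ^ 2 ≤ (6 * (ρ + z) ^ 2 + M * Ah) * (B * R ^ 2 + M / 6) := by
    have := mul_le_mul_of_nonneg_left hnb (show 0 ≤ R ^ 4 by positivity)
    have l1 : R ^ 4 * (M / R ^ 2 * (2 * (ρ / R) + z / R) ^ 2) = M * (2 * ρ + z) ^ 2 := by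
      field_simp
    have l2 : R ^ 4 * ((6 * (ρ / R + z / R) ^ 2 + M / R ^ 2 * Ah) * (B + M / R ^ 2 / 6))
        = (6 * (ρ + z) ^ 2 + M * Ah) * (B * R ^ 2 + M / 6) := by
      field_simp
    rwa [l1, l2] at this
  have hsplit : |calibR 0 z ρ| * R * p - (6 * (ρ + z) ^ 2 + M * Ah) * p ^ 2
      ≤ 9 * R ^ 2 * (B * R ^ 2 + M / 6) / M * z ^ 2 := by
    apply linear_sub_quadratic_le (by positivity)
    rw [hcal, mul_pow, sq_abs]
    have := mul_le_mul_of_nonneg_left hnb' (show 0 ≤ 36 * z ^ 2 * R ^ 2 / M by positivity)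
    have l1 : 36 * z ^ 2 * R ^ 2 / M * (M * (2 * ρ + z) ^ 2)
        = (6 * z * (2 * ρ + z)) ^ 2 * R ^ 2 := by field_simp; ring
    have l2 : 36 * z ^ 2 * R ^ 2 / M * ((6 * (ρ + z) ^ 2 + M * Ah) * (B * R ^ 2 + M / 6))
        = 4 * (6 * (ρ + z) ^ 2 + M * Ah) * (9 * R ^ 2 * (B * R ^ 2 + M / 6) / M * z ^ 2) := by
      field_simp; ring
    rwa [l1, l2] at this
  have e2 : 9 * R ^ 2 * (B * R ^ 2 + M / 6) / M = 3 / 2 * R ^ 2 + B * M ^ 2 / ν := by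
    have : 9 * R ^ 4 = M ^ 3 / ν := by rw [hMR]; field_simp
    have : 9 * R ^ 2 * (B * R ^ 2 + M / 6) / M = B * (9 * R ^ 4) / M + 3 / 2 * R ^ 2 := by
      field_simp; ring
    rw [this, ‹9 * R ^ 4 = M ^ 3 / ν›]; field_simp; ring
  have key : (2 + M * A) ^ 2 / 4 + B * M ^ 2 ≤ 3 / 2 * (M ^ 2 + 1) := by
    have h1 : (2 + M * A) ^ 2 / 4 + B * M ^ 2
        = 3 / 2 * (M ^ 2 + 1) - 1 / 2 * (M * A - 1) ^ 2 := by rw [hB]; ring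
    linarith [sq_nonneg (M * A - 1)]
  have hkz := mul_le_mul_of_nonneg_right key (show 0 ≤ z ^ 2 / ν by positivity)
  have e3 : (2 * z + z * (M * A)) ^ 2 / (4 * ν) + B * M ^ 2 / ν * z ^ 2
      = ((2 + M * A) ^ 2 / 4 + B * M ^ 2) * (z ^ 2 / ν) := by field_simp
  have e4 : 3 / 2 * (M ^ 2 + 1) * (z ^ 2 / ν) = 3 / 2 * ((M ^ 2 + 1) / ν) * z ^ 2 := by
    field_simp
  rw [e2] at hsplit
  linarith

/-- There is a calibration whose pointwise defect is controlled by the constant `C* - 1`. -/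
lemma exists_calibration {ν R : ℝ} (hν : 0 < ν) (hR : 0 ≤ R) :
    ∃ a b c q : ℝ, 0 < q ∧ ∀ z ρ p : ℝ, |ρ| ≤ R →
      (2 * z + z * (a + b * ρ ^ 2 + c * (z ^ 2 / (q + z ^ 2)))) ^ 2 / (4 * ν)
        - calibZ a b c q z ρ * p ^ 2 + |calibR b z ρ| * R * p ≤ (Cstar ν R - 1) * z ^ 2 := by
  -- Chosen so that M²/ν is the middle term (3R²)^(4/3) ν^(-1/3) of C*.
  set M : ℝ := (9 * R ^ 4 * ν) ^ (1 / 3 : ℝ) with hM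
  have hM0 : 0 ≤ M := by positivity
  have hM3 : M ^ 3 = 9 * R ^ 4 * ν := by
    rw [hM, ← Real.rpow_natCast, ← Real.rpow_mul (by positivity)]; norm_num
  have hC : Cstar ν R - 1 = 3 / 2 * (R ^ 2 + (M ^ 2 + 1) / ν) := by
    have : (3 * R ^ 2) ^ (4 / 3 : ℝ) * ν ^ (-1 / 3 : ℝ) = M ^ 2 / ν := by
      set K : ℝ := 3 * R ^ 2 with hK
      have hK0 : 0 ≤ K := by positivity
      have h1 : 9 * R ^ 4 * ν = K ^ (2 : ℝ) * ν := by
        rw [Real.rpow_two, hK]; ring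
      rw [hM, h1, ← Real.rpow_natCast, ← Real.rpow_mul (by positivity),
        Real.mul_rpow (by positivity) hν.le, ← Real.rpow_mul hK0, mul_div_assoc,
        ← Real.rpow_sub_one hν.ne']
      norm_num
    rw [Cstar, this]; field_simp; ring
  rw [hC]
  rcases le_or_gt (R ^ 2) M with h | h
  · refine ⟨M + 6 * (17 / 250) * R ^ 2, -(6 * (17 / 250)), 0, 1, one_pos, fun z ρ p hρ => ?_⟩
    have := pointwise_bound_of_sq_le (z := z) (p := p) hν hR hM0 hM3 h hρ
    simpa [calibZ] using this
  · refine ⟨2 / 5 * M, 0, 4 / 5 * M, R ^ 2, hM0.trans_lt h, fun z ρ p hρ => ?_⟩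
    have := pointwise_bound_of_lt_sq (z := z) (p := p) hν hR hM0 hM3 h hρ
    simpa [calibZ] using this

end CahnHilliard

/-! ### Mollification and its convergence in L¹ -/

noncomputable section
namespace CahnHilliard
variable {d : ℕ}

open ContinuousLinearMap (lsmul)
open scoped Convolution

/-- A sequence of smooth bump functions whose supports shrink to the origin. -/
def mollifier (d n : ℕ) : ContDiffBump (0 : EuclideanSpace ℝ (Fin d)) where
  rIn := 1 / ((n : ℝ) + 1)
  rOut := 2 * (1 / ((n : ℝ) + 1))
  rIn_pos := Nat.one_div_pos_of_nat
  rIn_lt_rOut := by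
    have : 0 < 1 / ((n : ℝ) + 1) := Nat.one_div_pos_of_nat
    linarith

lemma tendsto_mollifier_rOut (d : ℕ) : Tendsto (fun n => (mollifier d n).rOut) atTop (𝓝 0) := by
  have := (tendsto_one_div_add_atTop_nhds_zero_nat (𝕜 := ℝ)).const_mul 2
  simpa [mollifier] using this

/-- The mollification of a function. -/
def mollify (n : ℕ) (f : EuclideanSpace ℝ (Fin d) → ℝ) : EuclideanSpace ℝ (Fin d) → ℝ :=
  (mollifier d n).normed volume ⋆[lsmul ℝ ℝ, volume] f

lemma mollify_ae_tendsto {f : EuclideanSpace ℝ (Fin d) → ℝ} (hf : LocallyIntegrable f) :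
    ∀ᵐ x, Tendsto (fun n => mollify n f x) atTop (𝓝 (f x)) :=
  ContDiffBump.ae_convolution_tendsto_right_of_locallyIntegrable (K := 2)
    (tendsto_mollifier_rOut d) (Eventually.of_forall fun _ => le_rfl) hf

lemma contDiff_mollify (n : ℕ) {f : EuclideanSpace ℝ (Fin d) → ℝ} (hf : LocallyIntegrable f) :
    ContDiff ℝ 1 (mollify n f) :=
  ((mollifier d n).hasCompactSupport_normed).contDiff_convolution_left (n := 1) _
    (mollifier d n).contDiff_normed hf

lemma integrable_mollify (n : ℕ) {f : EuclideanSpace ℝ (Fin d) → ℝ} (hf : Integrable f) :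
    Integrable (mollify n f) :=
  (mollifier d n).integrable_normed.integrable_convolution _ hf

lemma integral_mollify (n : ℕ) {f : EuclideanSpace ℝ (Fin d) → ℝ} (hf : Integrable f) :
    ∫ x, mollify n f x = ∫ x, f x := by
  rw [mollify, integral_convolution _ (mollifier d n).integrable_normed hf,
    ContDiffBump.integral_normed]
  simp

lemma mollify_sub (n : ℕ) {f g : EuclideanSpace ℝ (Fin d) → ℝ} (hf : LocallyIntegrable f)
    (hg : LocallyIntegrable g) : mollify n (f - g) = mollify n f - mollify n g := by
  have hc := (mollifier d n).hasCompactSupport_normed (μ := volume)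
  have hcont := (mollifier d n).continuous_normed (μ := volume)
  have hgneg : mollify n (-g) = - mollify n g := by
    have : -g = (-1 : ℝ) • g := by simp
    rw [mollify, this, convolution_smul, neg_one_smul]; rfl
  rw [sub_eq_add_neg, sub_eq_add_neg, ← hgneg, mollify, mollify, mollify,
    ConvolutionExists.distrib_add]
  · exact hc.convolutionExists_left _ hcont hf
  · exact hc.convolutionExists_left _ hcont hg.neg

lemma mollify_nonneg (n : ℕ) {f : EuclideanSpace ℝ (Fin d) → ℝ} (hf : 0 ≤ f) :
    0 ≤ mollify n f := fun _ =>
  integral_nonneg fun t => mul_nonneg ((mollifier d n).nonneg_normed t) (hf _)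

/-- Scheffé's argument: mollification preserves the integral, so the L¹ distance is twice the
integral of the positive part of f - fₙ, which is dominated by f and tends to zero almost
everywhere. -/
lemma tendsto_integral_abs_mollify_sub_of_nonneg {f : EuclideanSpace ℝ (Fin d) → ℝ}
    (hf : Integrable f) (h0 : 0 ≤ f) :
    Tendsto (fun n => ∫ x, |mollify n f x - f x|) atTop (𝓝 0) := by
  have h1 : ∀ n, ∫ x, |mollify n f x - f x| = 2 * ∫ x, max (f x - mollify n f x) 0 := by
    intro n
    have hi : Integrable fun x => f x - mollify n f x := hf.sub (integrable_mollify n hf)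
    have e : ∀ x, |mollify n f x - f x|
        = 2 * max (f x - mollify n f x) 0 - (f x - mollify n f x) := by
      intro x
      rcases le_total (f x) (mollify n f x) with h | h
      · rw [abs_of_nonneg (by linarith), max_eq_right (by linarith)]; ring
      · rw [abs_of_nonpos (by linarith), max_eq_left (by linarith)]; ring
    simp_rw [e]
    rw [integral_sub (hi.pos_part.const_mul 2) hi, integral_const_mul,
      integral_sub hf (integrable_mollify n hf), integral_mollify n hf]
    simp
  simp_rw [h1]
  have h2 : Tendsto (fun n => ∫ x, max (f x - mollify n f x) 0) atTop
      (𝓝 (∫ _ : EuclideanSpace ℝ (Fin d), (0 : ℝ))) := by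
    refine tendsto_integral_of_dominated_convergence f
      (fun n => (hf.sub (integrable_mollify n hf)).pos_part.aestronglyMeasurable) hf
      (fun n => Eventually.of_forall fun x => ?_) ?_
    · rw [Real.norm_of_nonneg (le_max_right _ _)]
      have h2 : (0 : ℝ) ≤ mollify n f x := mollify_nonneg n h0 x
      exact max_le (by linarith) (h0 x)
    · filter_upwards [mollify_ae_tendsto hf.locallyIntegrable] with x hx
      have := ((tendsto_const_nhds (x := f x)).sub hx).max (tendsto_const_nhds (x := (0 : ℝ)))
      simpa using this
  simpa using h2.const_mul 2

/-- Mollifications converge in the mean. -/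
lemma tendsto_integral_abs_mollify_sub {f : EuclideanSpace ℝ (Fin d) → ℝ} (hf : Integrable f) :
    Tendsto (fun n => ∫ x, |mollify n f x - f x|) atTop (𝓝 0) := by
  set a : EuclideanSpace ℝ (Fin d) → ℝ := fun x => max (f x) 0 with ha
  set b : EuclideanSpace ℝ (Fin d) → ℝ := fun x => max (-f x) 0 with hb
  have hai : Integrable a := hf.pos_part
  have hbi : Integrable b := hf.neg_part
  have hfab : f = a - b := by
    funext x; simp only [ha, hb, Pi.sub_apply]
    rcases le_total (f x) 0 with h | h
    · rw [max_eq_right h, max_eq_left (by linarith)]; ring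
    · rw [max_eq_left h, max_eq_right (by linarith)]; ring
  have h1 := tendsto_integral_abs_mollify_sub_of_nonneg hai (fun x => le_max_right _ _)
  have h2 := tendsto_integral_abs_mollify_sub_of_nonneg hbi (fun x => le_max_right _ _)
  have h3 := h1.add h2
  rw [add_zero] at h3
  have ia : ∀ n, Integrable fun x => |mollify n a x - a x| :=
    fun n => ((integrable_mollify n hai).sub hai).abs
  have ib : ∀ n, Integrable fun x => |mollify n b x - b x| :=
    fun n => ((integrable_mollify n hbi).sub hbi).abs
  refine squeeze_zero (fun n => integral_nonneg fun x => abs_nonneg _) (fun n => ?_) h3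
  rw [← integral_add (ia n) (ib n)]
  refine integral_mono ((integrable_mollify n hf).sub hf).abs ((ia n).add (ib n)) fun x => ?_
  have : mollify n f x - f x = (mollify n a x - a x) - (mollify n b x - b x) := by
    conv_lhs => rw [hfab, mollify_sub n hai.locallyIntegrable hbi.locallyIntegrable]
    simp only [Pi.sub_apply]; ring
  simp only [this]
  exact abs_sub _ _

/-- Serves the limit in the chain rule, where the composed factor converges boundedly almost
everywhere and the mollified derivative converges only in L¹. -/
lemma tendsto_integral_mul_of_bounded {α : Type*} [MeasurableSpace α] {μ : Measure α}
    {a : ℕ → α → ℝ} {a₀ : α → ℝ} {h : ℕ → α → ℝ} {h₀ : α → ℝ} {C : ℝ}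
    (ha : ∀ n, AEStronglyMeasurable (a n) μ) (hC : ∀ n x, |a n x| ≤ C)
    (hlim : ∀ᵐ x ∂μ, Tendsto (fun n => a n x) atTop (𝓝 (a₀ x)))
    (hi : ∀ n, Integrable (h n) μ) (hi₀ : Integrable h₀ μ)
    (hh : Tendsto (fun n => ∫ x, |h n x - h₀ x| ∂μ) atTop (𝓝 0)) :
    Tendsto (fun n => ∫ x, a n x * h n x ∂μ) atTop (𝓝 (∫ x, a₀ x * h₀ x ∂μ)) := by
  have i1 : ∀ n, Integrable (fun x => a n x * h₀ x) μ := fun n =>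
    hi₀.bdd_mul (ha n) (Eventually.of_forall fun x => by rw [Real.norm_eq_abs]; exact hC n x)
  have i2 : ∀ n, Integrable (fun x => a n x * (h n x - h₀ x)) μ := fun n =>
    ((hi n).sub hi₀).bdd_mul (ha n)
      (Eventually.of_forall fun x => by rw [Real.norm_eq_abs]; exact hC n x)
  have t1 : Tendsto (fun n => ∫ x, a n x * h₀ x ∂μ) atTop (𝓝 (∫ x, a₀ x * h₀ x ∂μ)) := by
    refine tendsto_integral_of_dominated_convergence (fun x => C * |h₀ x|)
      (fun n => (i1 n).aestronglyMeasurable) (hi₀.abs.const_mul C)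
      (fun n => Eventually.of_forall fun x => ?_) ?_
    · rw [Real.norm_eq_abs, abs_mul]
      exact mul_le_mul_of_nonneg_right (hC n x) (abs_nonneg _)
    · filter_upwards [hlim] with x hx using hx.mul_const _
  have t2 : Tendsto (fun n => ∫ x, a n x * (h n x - h₀ x) ∂μ) atTop (𝓝 0) := by
    have hb := hh.const_mul C
    rw [mul_zero] at hb
    refine squeeze_zero_norm (fun n => ?_) hb
    rw [← integral_const_mul]
    refine (norm_integral_le_integral_norm _).trans
      (integral_mono (i2 n).norm (((hi n).sub hi₀).abs.const_mul C) fun x => ?_)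
    simp only [Real.norm_eq_abs, abs_mul]
    exact mul_le_mul_of_nonneg_right (hC n x) (abs_nonneg _)
  have t3 := t1.add t2
  rw [add_zero] at t3
  refine t3.congr fun n => ?_
  rw [← integral_add (i1 n) (i2 n)]
  exact integral_congr_ae (Eventually.of_forall fun x => by simp only; ring)

/-! ### The weak chain rule -/

section chain

variable {Ω : Set (EuclideanSpace ℝ (Fin d))} {i : Fin d}

lemma integrable_indicator_L2 [IsFiniteMeasure (volume.restrict Ω)] (hΩ : MeasurableSet Ω)
    (f : L2 Ω) : Integrable (Ω.indicator f) :=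
  (integrable_indicator_iff hΩ).2 ((Lp.memLp f).integrable one_le_two)

/-- Away from the boundary, mollification commutes with weak derivatives. -/
lemma fderiv_mollify_of_hasWeakPartial [IsFiniteMeasure (volume.restrict Ω)]
    (hΩ : MeasurableSet Ω) {f g : L2 Ω} (h : HasWeakPartial Ω i f g) {n : ℕ}
    {x : EuclideanSpace ℝ (Fin d)} (hx : Metric.closedBall x (mollifier d n).rOut ⊆ Ω) :
    fderiv ℝ (mollify n (Ω.indicator f)) x (EuclideanSpace.single i 1)
      = mollify n (Ω.indicator g) x := by
  set η : EuclideanSpace ℝ (Fin d) → ℝ := (mollifier d n).normed volume with hη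
  have hηc : HasCompactSupport η := (mollifier d n).hasCompactSupport_normed
  have hηs : ContDiff ℝ ∞ η := (mollifier d n).contDiff_normed
  have hF := (integrable_indicator_L2 hΩ f).locallyIntegrable
  set e : EuclideanSpace ℝ (Fin d) := EuclideanSpace.single i 1
  -- the translated and reflected kernel is a test function
  set θ : EuclideanSpace ℝ (Fin d) → ℝ := fun t => η (x - t) with hθ
  have hθs : ContDiff ℝ ∞ θ := hηs.comp (contDiff_const.sub contDiff_id)
  have hsupp : tsupport θ ⊆ Metric.closedBall x (mollifier d n).rOut := by
    refine closure_minimal (fun t ht => ?_) Metric.isClosed_closedBall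
    have h1 : x - t ∈ Function.support η := ht
    rw [hη, ContDiffBump.support_normed_eq, Metric.mem_ball, dist_zero_right] at h1
    rw [Metric.mem_closedBall, dist_comm, dist_eq_norm]
    exact h1.le
  have hθc : HasCompactSupport θ :=
    (isCompact_closedBall x _).of_isClosed_subset (isClosed_tsupport θ) hsupp
  have hfd : ∀ t, fderiv ℝ θ t e = - fderiv ℝ η (x - t) e := by
    intro t
    have h1 : HasFDerivAt θ ((fderiv ℝ η (x - t)).comp (-ContinuousLinearMap.id ℝ _)) t := by
      have h2 := (hηs.differentiable (by simp)).differentiableAt (x := x - t) |>.hasFDerivAt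
      have h3 : HasFDerivAt (fun t => x - t) (-ContinuousLinearMap.id ℝ
        (EuclideanSpace ℝ (Fin d))) t := (hasFDerivAt_id t).const_sub x
      exact h2.comp t h3
    rw [h1.fderiv]; simp
  have key := h θ hθs hθc (hsupp.trans hx)
  have hflip : mollify n (Ω.indicator f) = (Ω.indicator f) ⋆[(lsmul ℝ ℝ).flip, volume] η :=
    (convolution_flip _).symm
  -- The factors were swapped so that the derivative falls on the smooth kernel.
  have hder := hηc.hasFDerivAt_convolution_right (lsmul ℝ ℝ).flip hF (hηs.of_le (by simp)) x
  rw [hflip, hder.fderiv, convolution_precompR_apply _ hF (hηc.fderiv (𝕜 := ℝ))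
    (hηs.continuous_fderiv (by simp))]
  have hg : mollify n (Ω.indicator g) x = ∫ t, Ω.indicator g t * θ t := by
    have : mollify n (Ω.indicator g) = (Ω.indicator g) ⋆[(lsmul ℝ ℝ).flip, volume] η :=
      (convolution_flip _).symm
    rw [this, convolution_def]
    exact integral_congr_ae (Eventually.of_forall fun t => by
      simp [hθ, mul_comm])
  have hf : ((Ω.indicator f) ⋆[(lsmul ℝ ℝ).flip, volume] fun a => fderiv ℝ η a e) x
      = - ∫ t, Ω.indicator f t * fderiv ℝ θ t e := by
    rw [convolution_def, ← integral_neg]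
    exact integral_congr_ae (Eventually.of_forall fun t => by
      simp only [hfd]; simp [mul_comm])
  have hind : ∀ (u : EuclideanSpace ℝ (Fin d) → ℝ) (k : EuclideanSpace ℝ (Fin d) → ℝ),
      ∫ t, Ω.indicator u t * k t = ∫ t in Ω, u t * k t := by
    intro u k
    rw [← integral_indicator hΩ]
    exact integral_congr_ae (Eventually.of_forall fun t => by
      by_cases ht : t ∈ Ω <;> simp [ht])
  rw [hf, hg, hind, hind, key, neg_neg]

open ContinuousLinearMap in
/-- The chain rule for a bounded `C¹` function of two functions with weak partial derivatives. -/
lemma HasWeakPartial.comp₂ [IsFiniteMeasure (volume.restrict Ω)] (hΩ : IsOpen Ω)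
    {f f' g g' w w' : L2 Ω} (hf : HasWeakPartial Ω i f f') (hg : HasWeakPartial Ω i g g')
    {Φ Φ₁ Φ₂ : ℝ → ℝ → ℝ} {C : ℝ}
    (hΦ : ∀ a b, HasFDerivAt (fun p : ℝ × ℝ => Φ p.1 p.2)
      (Φ₁ a b • fst ℝ ℝ ℝ + Φ₂ a b • snd ℝ ℝ ℝ) (a, b))
    (hc₁ : Continuous fun p : ℝ × ℝ => Φ₁ p.1 p.2) (hc₂ : Continuous fun p : ℝ × ℝ => Φ₂ p.1 p.2)
    (hb : ∀ a b, |Φ a b| ≤ C) (hb₁ : ∀ a b, |Φ₁ a b| ≤ C) (hb₂ : ∀ a b, |Φ₂ a b| ≤ C)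
    (hw : w =ᵐ[volume.restrict Ω] fun x => Φ (f x) (g x))
    (hw' : w' =ᵐ[volume.restrict Ω] fun x => Φ₁ (f x) (g x) * f' x + Φ₂ (f x) (g x) * g' x) :
    HasWeakPartial Ω i w w' := by
  intro θ hθ hθc hθΩ
  set e : EuclideanSpace ℝ (Fin d) := EuclideanSpace.single i 1
  have hm := hΩ.measurableSet
  have hc : Continuous fun p : ℝ × ℝ => Φ p.1 p.2 :=
    continuous_iff_continuousAt.2 fun p => (hΦ p.1 p.2).continuousAt
  set F := Ω.indicator f
  set F' := Ω.indicator f'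
  set G := Ω.indicator g
  set G' := Ω.indicator g'
  have iF : Integrable F := integrable_indicator_L2 hm f
  have iF' : Integrable F' := integrable_indicator_L2 hm f'
  have iG : Integrable G := integrable_indicator_L2 hm g
  have iG' : Integrable G' := integrable_indicator_L2 hm g'
  have cF : ∀ n, ContDiff ℝ 1 (mollify n F) := fun n => contDiff_mollify n iF.locallyIntegrable
  have cG : ∀ n, ContDiff ℝ 1 (mollify n G) := fun n => contDiff_mollify n iG.locallyIntegrable
  have cF' : ∀ n, Continuous (mollify n F') :=
    fun n => (contDiff_mollify n iF'.locallyIntegrable).continuous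
  have cG' : ∀ n, Continuous (mollify n G') :=
    fun n => (contDiff_mollify n iG'.locallyIntegrable).continuous
  have cFG : ∀ n, Continuous fun x => (mollify n F x, mollify n G x) :=
    fun n => (cF n).continuous.prodMk (cG n).continuous
  have hθ' : Continuous fun x => fderiv ℝ θ x e :=
    (hθ.continuous_fderiv (by simp)).clm_apply continuous_const
  have hθ'c : HasCompactSupport fun x => fderiv ℝ θ x e := hθc.fderiv_apply (𝕜 := ℝ) e
  -- the smooth identity
  have hsmooth : ∀ᶠ n in atTop,
      ∫ x, Φ (mollify n F x) (mollify n G x) * fderiv ℝ θ x e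
        = - ((∫ x, (Φ₁ (mollify n F x) (mollify n G x) * θ x) * mollify n F' x)
            + ∫ x, (Φ₂ (mollify n F x) (mollify n G x) * θ x) * mollify n G' x) := by
    -- The support of θ keeps a distance δ from the boundary. For mollification radii below δ the
    -- jump of the zero extension across ∂Ω is therefore never seen where θ lives.
    obtain ⟨δ, hδ, hsub⟩ := hθc.isCompact.exists_cthickening_subset_open hΩ hθΩ
    filter_upwards [(tendsto_mollifier_rOut d).eventually (gt_mem_nhds hδ)] with n hn
    have hball : ∀ x ∈ tsupport θ, Metric.closedBall x (mollifier d n).rOut ⊆ Ω := fun x hx =>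
      ((Metric.closedBall_subset_closedBall hn.le).trans
        (Metric.closedBall_subset_cthickening hx δ)).trans hsub
    have hder : ∀ x, HasFDerivAt (fun x => Φ (mollify n F x) (mollify n G x))
        (Φ₁ (mollify n F x) (mollify n G x) • fderiv ℝ (mollify n F) x
          + Φ₂ (mollify n F x) (mollify n G x) • fderiv ℝ (mollify n G) x) x := by
      intro x
      have h1 := ((cF n).differentiable one_ne_zero x).hasFDerivAt
      have h2 := ((cG n).differentiable one_ne_zero x).hasFDerivAt
      have h3 := (hΦ (mollify n F x) (mollify n G x)).comp x (h1.prodMk h2)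
      have h4 : Φ₁ (mollify n F x) (mollify n G x) • fderiv ℝ (mollify n F) x
          + Φ₂ (mollify n F x) (mollify n G x) • fderiv ℝ (mollify n G) x
          = (Φ₁ (mollify n F x) (mollify n G x) • fst ℝ ℝ ℝ
            + Φ₂ (mollify n F x) (mollify n G x) • snd ℝ ℝ ℝ).comp
            ((fderiv ℝ (mollify n F) x).prod (fderiv ℝ (mollify n G) x)) := by
        ext v
        simp
      rw [h4]
      exact h3
    have hpt : ∀ x, fderiv ℝ (fun x => Φ (mollify n F x) (mollify n G x)) x e * θ x
        = (Φ₁ (mollify n F x) (mollify n G x) * θ x) * mollify n F' x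
          + (Φ₂ (mollify n F x) (mollify n G x) * θ x) * mollify n G' x := by
      intro x
      by_cases hx : x ∈ tsupport θ
      · rw [(hder x).fderiv]
        simp only [_root_.add_apply, _root_.smul_apply, smul_eq_mul]
        rw [fderiv_mollify_of_hasWeakPartial hm hf (hball x hx),
          fderiv_mollify_of_hasWeakPartial hm hg (hball x hx)]
        ring
      · rw [image_eq_zero_of_notMem_tsupport hx]; ring
    have c1 : Continuous fun x => (Φ₁ (mollify n F x) (mollify n G x) * θ x) * mollify n F' x :=
      ((hc₁.comp (cFG n)).mul hθ.continuous).mul (cF' n)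
    have c2 : Continuous fun x => (Φ₂ (mollify n F x) (mollify n G x) * θ x) * mollify n G' x :=
      ((hc₂.comp (cFG n)).mul hθ.continuous).mul (cG' n)
    have i1 := c1.integrable_of_hasCompactSupport (μ := volume) hθc.mul_left.mul_right
    have i2 := c2.integrable_of_hasCompactSupport (μ := volume) hθc.mul_left.mul_right
    rw [integral_mul_fderiv_eq_neg_fderiv_mul_of_integrable, ← integral_add i1 i2]
    · exact congrArg Neg.neg (integral_congr_ae (Eventually.of_forall hpt))
    · exact (i1.add i2).congr (Eventually.of_forall fun x => (hpt x).symm)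
    · exact ((hc.comp (cFG n)).mul hθ').integrable_of_hasCompactSupport hθ'c.mul_left
    · exact ((hc.comp (cFG n)).mul hθ.continuous).integrable_of_hasCompactSupport hθc.mul_left
    · exact fun x _ => (hder x).differentiableAt
    · exact fun x _ => (hθ.differentiable (by simp)) x
  -- passage to the limit
  have aF := mollify_ae_tendsto iF.locallyIntegrable
  have aG := mollify_ae_tendsto iG.locallyIntegrable
  have hlim : ∀ {Ψ : ℝ → ℝ → ℝ}, (Continuous fun p : ℝ × ℝ => Ψ p.1 p.2) →
      ∀ᵐ x, Tendsto (fun n => Ψ (mollify n F x) (mollify n G x)) atTop (𝓝 (Ψ (F x) (G x))) := by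
    intro Ψ hΨ
    filter_upwards [aF, aG] with x h1 h2
    exact (hΨ.tendsto (F x, G x)).comp (h1.prodMk_nhds h2)
  obtain ⟨C', hC'⟩ := hθ.continuous.bounded_above_of_compact_support hθc
  have hC0 : 0 ≤ C := (abs_nonneg _).trans (hb 0 0)
  have hbθ : ∀ {Ψ : ℝ → ℝ → ℝ}, (∀ a b, |Ψ a b| ≤ C) → ∀ n x,
      |Ψ (mollify n F x) (mollify n G x) * θ x| ≤ C * C' := fun hΨ n x => by
    rw [abs_mul]
    exact mul_le_mul (hΨ _ _) (hC' x) (abs_nonneg _) hC0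
  have t0 : Tendsto (fun n => ∫ x, Φ (mollify n F x) (mollify n G x) * fderiv ℝ θ x e) atTop
      (𝓝 (∫ x, Φ (F x) (G x) * fderiv ℝ θ x e)) :=
    tendsto_integral_mul_of_bounded
      (fun n => (hc.comp (cFG n)).aestronglyMeasurable) (fun n x => hb _ _) (hlim hc)
      (fun _ => hθ'.integrable_of_hasCompactSupport hθ'c)
      (hθ'.integrable_of_hasCompactSupport hθ'c) (by simp)
  have t1 : Tendsto (fun n => ∫ x, (Φ₁ (mollify n F x) (mollify n G x) * θ x) * mollify n F' x)
      atTop (𝓝 (∫ x, (Φ₁ (F x) (G x) * θ x) * F' x)) := by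
    refine tendsto_integral_mul_of_bounded
      (fun n => ((hc₁.comp (cFG n)).mul hθ.continuous).aestronglyMeasurable) (hbθ hb₁) ?_
      (fun n => integrable_mollify n iF') iF' (tendsto_integral_abs_mollify_sub iF')
    filter_upwards [hlim hc₁] with x hx using hx.mul_const _
  have t2 : Tendsto (fun n => ∫ x, (Φ₂ (mollify n F x) (mollify n G x) * θ x) * mollify n G' x)
      atTop (𝓝 (∫ x, (Φ₂ (F x) (G x) * θ x) * G' x)) := by
    refine tendsto_integral_mul_of_bounded
      (fun n => ((hc₂.comp (cFG n)).mul hθ.continuous).aestronglyMeasurable) (hbθ hb₂) ?_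
      (fun n => integrable_mollify n iG') iG' (tendsto_integral_abs_mollify_sub iG')
    filter_upwards [hlim hc₂] with x hx using hx.mul_const _
  have hfin := tendsto_nhds_unique (t0.congr' hsmooth) (t1.add t2).neg
  -- back to integrals over the domain
  have hz : ∀ x ∉ Ω, θ x = 0 := fun x hx => image_eq_zero_of_notMem_tsupport fun h => hx (hθΩ h)
  have hz' : ∀ x ∉ Ω, fderiv ℝ θ x e = 0 := fun x hx =>
    image_eq_zero_of_notMem_tsupport (f := fun x => fderiv ℝ θ x e) fun h =>
      hx (hθΩ <| by exact tsupport_fderiv_apply_subset ℝ e h)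
  have l1 : ∫ x in Ω, w x * fderiv ℝ θ x e = ∫ x, Φ (F x) (G x) * fderiv ℝ θ x e := by
    rw [← setIntegral_eq_integral_of_forall_compl_eq_zero (s := Ω) (μ := volume)
      (f := fun x => Φ (F x) (G x) * fderiv ℝ θ x e) (fun x hx => by rw [hz' x hx, mul_zero])]
    refine integral_congr_ae ?_
    filter_upwards [hw, ae_restrict_mem hm] with x hx hxΩ
    rw [hx]
    simp [F, G, hxΩ]
  have i1 : Integrable fun x => (Φ₁ (F x) (G x) * θ x) * F' x := by
    refine iF'.bdd_mul (c := C * C') ?_ (Eventually.of_forall fun x => ?_)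
    · exact (hc₁.comp_aestronglyMeasurable
        (iF.aestronglyMeasurable.prodMk iG.aestronglyMeasurable)).mul
        hθ.continuous.aestronglyMeasurable
    · rw [norm_mul]
      exact mul_le_mul (hb₁ _ _) (hC' x) (norm_nonneg _) hC0
  have i2 : Integrable fun x => (Φ₂ (F x) (G x) * θ x) * G' x := by
    refine iG'.bdd_mul (c := C * C') ?_ (Eventually.of_forall fun x => ?_)
    · exact (hc₂.comp_aestronglyMeasurable
        (iF.aestronglyMeasurable.prodMk iG.aestronglyMeasurable)).mul
        hθ.continuous.aestronglyMeasurable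
    · rw [norm_mul]
      exact mul_le_mul (hb₂ _ _) (hC' x) (norm_nonneg _) hC0
  have l2 : ∫ x in Ω, w' x * θ x
      = (∫ x, (Φ₁ (F x) (G x) * θ x) * F' x) + ∫ x, (Φ₂ (F x) (G x) * θ x) * G' x := by
    rw [← integral_add i1 i2, ← setIntegral_eq_integral_of_forall_compl_eq_zero (s := Ω)
      (μ := volume) (f := fun x => (Φ₁ (F x) (G x) * θ x) * F' x + (Φ₂ (F x) (G x) * θ x) * G' x)
      (fun x hx => by rw [hz x hx]; ring)]
    refine integral_congr_ae ?_
    filter_upwards [hw', ae_restrict_mem hm] with x hx hxΩ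
    rw [hx]
    simp only [F, G, F', G', Set.indicator_of_mem hxΩ]
    ring
  rw [l1, l2, hfin]

end chain

end CahnHilliard
end

/-! ### Truncation and a Fatou criterion -/

noncomputable section
namespace CahnHilliard
variable {d : ℕ}

/-- A smooth bounded truncation of the identity. -/
def trunc (n : ℕ) (s : ℝ) : ℝ := ((n : ℝ) + 1) * Real.arctan (s / ((n : ℝ) + 1))

/-- The derivative of `trunc`. -/
def truncDeriv (n : ℕ) (s : ℝ) : ℝ := 1 / (1 + (s / ((n : ℝ) + 1)) ^ 2)

lemma hasDerivAt_trunc (n : ℕ) (s : ℝ) : HasDerivAt (trunc n) (truncDeriv n s) s := by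
  have hn : ((n : ℝ) + 1) ≠ 0 := by positivity
  have h := (((hasDerivAt_id s).div_const ((n : ℝ) + 1)).arctan).const_mul ((n : ℝ) + 1)
  refine h.congr_deriv ?_
  simp only [truncDeriv, id]
  field_simp

lemma continuous_trunc (n : ℕ) : Continuous (trunc n) :=
  continuous_iff_continuousAt.2 fun s => (hasDerivAt_trunc n s).continuousAt

lemma continuous_truncDeriv (n : ℕ) : Continuous (truncDeriv n) := by
  unfold truncDeriv
  exact continuous_const.div (by fun_prop) fun s => by positivity

lemma truncDeriv_nonneg (n : ℕ) (s : ℝ) : 0 ≤ truncDeriv n s := by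
  unfold truncDeriv; positivity

lemma truncDeriv_le_one (n : ℕ) (s : ℝ) : truncDeriv n s ≤ 1 := by
  unfold truncDeriv
  rw [div_le_one (by positivity)]
  linarith [sq_nonneg (s / ((n : ℝ) + 1))]

lemma abs_truncDeriv_le_one (n : ℕ) (s : ℝ) : |truncDeriv n s| ≤ 1 := by
  rw [abs_of_nonneg (truncDeriv_nonneg n s)]; exact truncDeriv_le_one n s

lemma abs_trunc_le (n : ℕ) (s : ℝ) : |trunc n s| ≤ ((n : ℝ) + 1) * (Real.pi / 2) := by
  rw [trunc, abs_mul, abs_of_pos (by positivity)]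
  exact mul_le_mul_of_nonneg_left (abs_le.2 ⟨(Real.neg_pi_div_two_lt_arctan _).le,
    (Real.arctan_lt_pi_div_two _).le⟩) (by positivity)

lemma abs_trunc_le_abs (n : ℕ) (s : ℝ) : |trunc n s| ≤ |s| := by
  have h := Convex.norm_image_sub_le_of_norm_hasDerivWithin_le (s := Set.univ) (C := 1)
    (f := trunc n) (f' := truncDeriv n) (x := 0) (y := s)
    (fun x _ => (hasDerivAt_trunc n x).hasDerivWithinAt) (fun x _ => abs_truncDeriv_le_one n x)
    convex_univ trivial trivial
  simpa [trunc] using h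

lemma tendsto_div_add_one (s : ℝ) : Tendsto (fun n : ℕ => s / ((n : ℝ) + 1)) atTop (𝓝 0) := by
  have := (tendsto_one_div_add_atTop_nhds_zero_nat (𝕜 := ℝ)).const_mul s
  simpa [div_eq_mul_inv] using this

lemma tendsto_truncDeriv (s : ℝ) : Tendsto (fun n => truncDeriv n s) atTop (𝓝 1) := by
  have h : Tendsto (fun t : ℝ => 1 / (1 + t ^ 2)) (𝓝 0) (𝓝 1) := by
    have : ContinuousAt (fun t : ℝ => 1 / (1 + t ^ 2)) 0 := by
      refine ContinuousAt.div (by fun_prop) (by fun_prop) (by norm_num)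
    simpa [ContinuousAt] using this
  exact h.comp (tendsto_div_add_one s)

lemma tendsto_trunc (s : ℝ) : Tendsto (fun n => trunc n s) atTop (𝓝 s) := by
  have hb : ∀ n, |trunc n s - s| ≤ |s| * |1 - truncDeriv n s| := by
    intro n
    -- On [-|s|, |s|] the derivative 1 - `truncDeriv` of the error is largest at the endpoints.
    have h := Convex.norm_image_sub_le_of_norm_hasDerivWithin_le (s := Set.Icc (-|s|) |s|)
      (C := |1 - truncDeriv n s|)
      (f := fun t => t - trunc n t) (f' := fun t => 1 - truncDeriv n t) (x := 0) (y := s)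
      (fun x _ => ((hasDerivAt_id x).sub (hasDerivAt_trunc n x)).hasDerivWithinAt)
      (fun x hx => ?_) (convex_Icc _ _) (by simp) ⟨neg_abs_le s, le_abs_self s⟩
    · simpa [trunc, abs_sub_comm, mul_comm] using h
    · rw [Real.norm_eq_abs, abs_of_nonneg (by linarith [truncDeriv_le_one n x]),
        abs_of_nonneg (by linarith [truncDeriv_le_one n s])]
      have hx2 : x ^ 2 ≤ s ^ 2 := sq_le_sq.2 (by rw [abs_le]; exact hx)
      have : truncDeriv n s ≤ truncDeriv n x := by
        unfold truncDeriv
        refine one_div_le_one_div_of_le (by positivity) ?_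
        rw [div_pow, div_pow]
        gcongr
      linarith
  have h1 : Tendsto (fun n => |s| * |1 - truncDeriv n s|) atTop (𝓝 0) := by
    have := (((tendsto_const_nhds (x := (1 : ℝ))).sub (tendsto_truncDeriv s)).abs).const_mul |s|
    simpa using this
  rw [tendsto_iff_dist_tendsto_zero]
  exact squeeze_zero (fun _ => dist_nonneg) (fun n => by rw [Real.dist_eq]; exact hb n) h1

/-- Fatou's lemma. -/
lemma integrable_of_tendsto_of_integral_le {α : Type*} [MeasurableSpace α] {μ : Measure α}
    {f : ℕ → α → ℝ} {g : α → ℝ} {B : ℝ} (hf : ∀ n, Integrable (f n) μ) (h0 : ∀ n x, 0 ≤ f n x)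
    (hlim : ∀ᵐ x ∂μ, Tendsto (fun n => f n x) atTop (𝓝 (g x))) (hB : ∀ n, ∫ x, f n x ∂μ ≤ B) :
    Integrable g μ := by
  refine ⟨aestronglyMeasurable_of_tendsto_ae atTop (fun n => (hf n).aestronglyMeasurable) hlim, ?_⟩
  have h1 : ∫⁻ x, ‖g x‖ₑ ∂μ = ∫⁻ x, liminf (fun n => ‖f n x‖ₑ) atTop ∂μ := by
    refine lintegral_congr_ae ?_
    filter_upwards [hlim] with x hx
    exact (hx.enorm.liminf_eq).symm
  have h2 : ∀ n, ∫⁻ x, ‖f n x‖ₑ ∂μ ≤ ENNReal.ofReal B := by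
    intro n
    rw [← ofReal_integral_norm_eq_lintegral_enorm (hf n)]
    refine ENNReal.ofReal_le_ofReal ?_
    simp_rw [Real.norm_of_nonneg (h0 n _)]
    exact hB n
  rw [hasFiniteIntegral_iff_enorm, h1]
  calc ∫⁻ x, liminf (fun n => ‖f n x‖ₑ) atTop ∂μ
      ≤ liminf (fun n => ∫⁻ x, ‖f n x‖ₑ ∂μ) atTop :=
        lintegral_liminf_le' fun n => (hf n).aestronglyMeasurable.enorm
    _ ≤ ENNReal.ofReal B := by
        refine liminf_le_of_frequently_le' (Frequently.of_forall h2)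
    _ < ⊤ := ENNReal.ofReal_lt_top

/-! ### Green's formula -/

variable {Ω : Set (EuclideanSpace ℝ (Fin d))}

/-- The function `∇v · ∇u`. -/
def gradDot (v u : Jet Ω) (x : EuclideanSpace ℝ (Fin d)) : ℝ := ∑ i, v.grad i x * u.grad i x

lemma integrable_mul_L2 (f g : L2 Ω) : Integrable (fun x => f x * g x) (volume.restrict Ω) :=
  (Lp.memLp f).integrable_mul (Lp.memLp g)

lemma integrable_gradDot (v u : Jet Ω) : Integrable (gradDot v u) (volume.restrict Ω) :=
  integrable_finsetSum _ fun i _ => integrable_mul_L2 (v.grad i) (u.grad i)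

lemma gradDot_self_nonneg (u : Jet Ω) (x : EuclideanSpace ℝ (Fin d)) : 0 ≤ gradDot u u x :=
  Finset.sum_nonneg fun _ _ => mul_self_nonneg _

lemma abs_gradDot_le {v u : Jet Ω} {R : ℝ} {x : EuclideanSpace ℝ (Fin d)}
    (hv : √(∑ i, (v.grad i x) ^ 2) ≤ R) : |gradDot v u x| ≤ R * √(gradDot u u x) := by
  have h := Finset.sum_mul_sq_le_sq_mul_sq Finset.univ (fun i => v.grad i x) (fun i => u.grad i x)
  have h2 : gradDot u u x = ∑ i, (u.grad i x) ^ 2 :=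
    Finset.sum_congr rfl fun i _ => (sq _).symm
  have h3 : |gradDot v u x| ≤ √(∑ i, (v.grad i x) ^ 2) * √(gradDot u u x) := by
    rw [← Real.sqrt_mul (Finset.sum_nonneg fun _ _ => sq_nonneg _), h2]
    exact Real.abs_le_sqrt h
  exact h3.trans (mul_le_mul_of_nonneg_right hv (Real.sqrt_nonneg _))

lemma inner_L2_eq (f g : L2 Ω) : inner ℝ f g = ∫ x in Ω, f x * g x := by
  rw [MeasureTheory.L2.inner_def]
  exact integral_congr_ae (Eventually.of_forall fun x => by simp [mul_comm])

open ContinuousLinearMap in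
/-- Green's formula for a bounded `C¹` function of two functions. -/
lemma green_of_bounded [IsFiniteMeasure (volume.restrict Ω)] (hΩ : IsOpen Ω) (u v : H2n Ω)
    {Φ Φ₁ Φ₂ : ℝ → ℝ → ℝ} {C : ℝ}
    (hΦ : ∀ a b, HasFDerivAt (fun p : ℝ × ℝ => Φ p.1 p.2)
      (Φ₁ a b • fst ℝ ℝ ℝ + Φ₂ a b • snd ℝ ℝ ℝ) (a, b))
    (hc₁ : Continuous fun p : ℝ × ℝ => Φ₁ p.1 p.2) (hc₂ : Continuous fun p : ℝ × ℝ => Φ₂ p.1 p.2)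
    (hb : ∀ a b, |Φ a b| ≤ C) (hb₁ : ∀ a b, |Φ₁ a b| ≤ C) (hb₂ : ∀ a b, |Φ₂ a b| ≤ C) :
    ∫ x in Ω, Φ (u.1.val x) (v.1.val x) * u.1.lap x
      = - ∫ x in Ω, (Φ₁ (u.1.val x) (v.1.val x) * gradDot u.1 u.1 x
          + Φ₂ (u.1.val x) (v.1.val x) * gradDot v.1 u.1 x) := by
  have hc : Continuous fun p : ℝ × ℝ => Φ p.1 p.2 :=
    continuous_iff_continuousAt.2 fun p => (hΦ p.1 p.2).continuousAt
  have hmeas : ∀ {Ψ : ℝ → ℝ → ℝ}, (Continuous fun p : ℝ × ℝ => Ψ p.1 p.2) →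
      AEStronglyMeasurable (fun x => Ψ (u.1.val x) (v.1.val x)) (volume.restrict Ω) :=
    fun hΨ => hΨ.comp_aestronglyMeasurable
      ((Lp.aestronglyMeasurable u.1.val).prodMk (Lp.aestronglyMeasurable v.1.val))
  have hW : MemLp (fun x => Φ (u.1.val x) (v.1.val x)) 2 (volume.restrict Ω) :=
    MemLp.of_bound (hmeas hc) C (Eventually.of_forall fun x => hb _ _)
  have hmul : ∀ {Ψ : ℝ → ℝ → ℝ}, (Continuous fun p : ℝ × ℝ => Ψ p.1 p.2) →
      (∀ a b, |Ψ a b| ≤ C) → ∀ f : L2 Ω,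
      MemLp (fun x => Ψ (u.1.val x) (v.1.val x) * f x) 2 (volume.restrict Ω) := by
    intro Ψ hΨ hΨb f
    refine MemLp.of_le_mul (c := C) (Lp.memLp f)
      ((hmeas hΨ).mul (Lp.aestronglyMeasurable f)) (Eventually.of_forall fun x => ?_)
    rw [norm_mul]
    exact mul_le_mul_of_nonneg_right (hΨb _ _) (norm_nonneg _)
  have hW' : ∀ i, MemLp (fun x => Φ₁ (u.1.val x) (v.1.val x) * u.1.grad i x
      + Φ₂ (u.1.val x) (v.1.val x) * v.1.grad i x) 2 (volume.restrict Ω) :=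
    fun i => (hmul hc₁ hb₁ _).add (hmul hc₂ hb₂ _)
  -- The Neumann condition is Green's formula against any w with weak gradient in L²; the
  -- composition Φ(u, v) qualifies by the chain rule.
  have hG := u.2.2.2 hW.toLp (fun i => (hW' i).toLp) fun i =>
    (u.2.1 i).comp₂ hΩ (v.2.1 i) hΦ hc₁ hc₂ hb hb₁ hb₂ hW.coeFn_toLp (hW' i).coeFn_toLp
  rw [inner_L2_eq] at hG
  simp_rw [inner_L2_eq] at hG
  rw [← integral_finsetSum _ (fun i _ => integrable_mul_L2 _ _)] at hG
  have e1 : ∫ x in Ω, u.1.lap x * (MemLp.toLp _ hW : L2 Ω) x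
      = ∫ x in Ω, Φ (u.1.val x) (v.1.val x) * u.1.lap x := by
    refine integral_congr_ae ?_
    filter_upwards [hW.coeFn_toLp] with x hx
    rw [hx, mul_comm]
  have e2 : ∫ x in Ω, ∑ i, u.1.grad i x * (MemLp.toLp _ (hW' i) : L2 Ω) x
      = ∫ x in Ω, (Φ₁ (u.1.val x) (v.1.val x) * gradDot u.1 u.1 x
          + Φ₂ (u.1.val x) (v.1.val x) * gradDot v.1 u.1 x) := by
    refine integral_congr_ae ?_
    filter_upwards [ae_all_iff.2 fun i => (hW' i).coeFn_toLp] with x hx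
    simp only [gradDot, Finset.mul_sum, ← Finset.sum_add_distrib]
    refine Finset.sum_congr rfl fun i _ => ?_
    rw [hx i]; ring
  rw [e1, e2] at hG
  rw [hG, neg_neg]

/-- The integrability of `u³ Δu` entails that of `u² |∇u|²`. -/
lemma integrable_sq_mul_gradDot [IsFiniteMeasure (volume.restrict Ω)] (hΩ : IsOpen Ω) (u : H2n Ω)
    (h3 : Integrable (fun x => |u.1.val x| ^ 3 * |u.1.lap x|) (volume.restrict Ω)) :
    Integrable (fun x => u.1.val x ^ 2 * gradDot u.1 u.1 x) (volume.restrict Ω) := by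
  have hmeas : ∀ {Ψ : ℝ → ℝ}, Continuous Ψ →
      AEStronglyMeasurable (fun x => Ψ (u.1.val x)) (volume.restrict Ω) :=
    fun hΨ => hΨ.comp_aestronglyMeasurable (Lp.aestronglyMeasurable u.1.val)
  have hcD : ∀ n, Continuous fun s => 3 * trunc n s ^ 2 * truncDeriv n s := fun n =>
    (continuous_const.mul ((continuous_trunc n).pow 2)).mul (continuous_truncDeriv n)
  have hI : Integrable (fun x => 3 * u.1.val x ^ 2 * gradDot u.1 u.1 x) (volume.restrict Ω) := by
    refine integrable_of_tendsto_of_integral_le (B := ∫ x in Ω, |u.1.val x| ^ 3 * |u.1.lap x|)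
      (f := fun n x => 3 * trunc n (u.1.val x) ^ 2 * truncDeriv n (u.1.val x)
        * gradDot u.1 u.1 x) (fun n => ?_) (fun n x => ?_) ?_ (fun n => ?_)
    · set L : ℝ := ((n : ℝ) + 1) * (Real.pi / 2)
      refine (integrable_gradDot u.1 u.1).bdd_mul (c := 3 * L ^ 2) (hmeas (hcD n))
        (Eventually.of_forall fun x => ?_)
      rw [norm_mul, norm_mul, Real.norm_of_nonneg (by norm_num : (0 : ℝ) ≤ 3), norm_pow,
        Real.norm_eq_abs, Real.norm_eq_abs]
      have h1 := pow_le_pow_left₀ (abs_nonneg _) (show _ ≤ L from abs_trunc_le n (u.1.val x)) 2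
      have h2 := abs_truncDeriv_le_one n (u.1.val x)
      have h0 : 0 ≤ 3 * L ^ 2 := by positivity
      calc 3 * |trunc n (u.1.val x)| ^ 2 * |truncDeriv n (u.1.val x)|
          ≤ 3 * L ^ 2 * 1 := mul_le_mul (by linarith) h2 (abs_nonneg _) h0
        _ = 3 * L ^ 2 := mul_one _
    · have := truncDeriv_nonneg n (u.1.val x)
      have := gradDot_self_nonneg u.1 x
      positivity
    · refine Eventually.of_forall fun x => ?_
      have := ((((tendsto_trunc (u.1.val x)).pow 2).const_mul 3).mul
        (tendsto_truncDeriv (u.1.val x))).mul_const (gradDot u.1 u.1 x)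
      simpa using this
    · set L : ℝ := ((n : ℝ) + 1) * (Real.pi / 2)
      have hL : 0 ≤ L := by positivity
      have hgreen := green_of_bounded hΩ u u (Φ := fun a _ => trunc n a ^ 3)
        (Φ₁ := fun a _ => 3 * trunc n a ^ 2 * truncDeriv n a) (Φ₂ := fun _ _ => 0)
        (C := L ^ 3 + 3 * L ^ 2) (fun a b => ?_) ((hcD n).comp continuous_fst) continuous_const
        (fun a b => ?_) (fun a b => ?_) (fun a b => ?_)
      · have e : ∫ x in Ω, 3 * trunc n (u.1.val x) ^ 2 * truncDeriv n (u.1.val x)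
            * gradDot u.1 u.1 x = ∫ x in Ω, - (trunc n (u.1.val x) ^ 3 * u.1.lap x) := by
          rw [integral_neg, hgreen, neg_neg]
          simp
        rw [e]
        refine (Real.le_norm_self _).trans (norm_integral_le_of_norm_le h3
          (Eventually.of_forall fun x => ?_))
        rw [norm_neg, norm_mul, norm_pow, Real.norm_eq_abs, Real.norm_eq_abs]
        exact mul_le_mul_of_nonneg_right
          (pow_le_pow_left₀ (abs_nonneg _) (abs_trunc_le_abs n _) 3) (abs_nonneg _)
      · have h1 := ((hasDerivAt_trunc n a).pow 3).hasFDerivAt.comp (a, b)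
          (hasFDerivAt_fst (𝕜 := ℝ) (E := ℝ) (F := ℝ) (p := (a, b)))
        refine h1.congr_fderiv ?_
        ext <;> simp [mul_comm]
      · have := pow_le_pow_left₀ (abs_nonneg _) (show _ ≤ L from abs_trunc_le n a) 3
        rw [abs_pow]
        have : 0 ≤ 3 * L ^ 2 := by positivity
        linarith
      · have h1 := pow_le_pow_left₀ (abs_nonneg _) (show _ ≤ L from abs_trunc_le n a) 2
        have h2 := abs_truncDeriv_le_one n a
        have h0 : 0 ≤ 3 * L ^ 2 := by positivity
        have h0' : 0 ≤ L ^ 3 := by positivity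
        rw [abs_mul, abs_mul, abs_of_pos (by norm_num : (0 : ℝ) < 3), abs_pow]
        calc 3 * |trunc n a| ^ 2 * |truncDeriv n a|
            ≤ 3 * L ^ 2 * 1 := mul_le_mul (by linarith) h2 (abs_nonneg _) h0
          _ ≤ L ^ 3 + 3 * L ^ 2 := by linarith
      · rw [abs_zero]; positivity
  exact (hI.div_const 3).congr (Eventually.of_forall fun x => by simp only; ring)

open ContinuousLinearMap in
/-- Green's formula for a `C¹` function of cubic growth, composed with functions `u` and `v` such
that `u³ Δu` is integrable and `v` is bounded in `W^{1,∞}`. -/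
lemma green_of_cubic_growth [IsFiniteMeasure (volume.restrict Ω)] (hΩ : IsOpen Ω) (u v : H2n Ω)
    {R C : ℝ} (hv : ∀ᵐ x ∂(volume.restrict Ω), |v.1.val x| ≤ R)
    (hv' : ∀ᵐ x ∂(volume.restrict Ω), √(∑ i, (v.1.grad i x) ^ 2) ≤ R)
    (h3 : Integrable (fun x => |u.1.val x| ^ 3 * |u.1.lap x|) (volume.restrict Ω))
    {e e₁ e₂ : ℝ → ℝ → ℝ}
    (he : ∀ a b, HasFDerivAt (fun p : ℝ × ℝ => e p.1 p.2)
      (e₁ a b • fst ℝ ℝ ℝ + e₂ a b • snd ℝ ℝ ℝ) (a, b))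
    (hc₁ : Continuous fun p : ℝ × ℝ => e₁ p.1 p.2) (hc₂ : Continuous fun p : ℝ × ℝ => e₂ p.1 p.2)
    (hb : ∀ a b, |b| ≤ R → |e a b| ≤ C * (|a| + |a| ^ 3))
    (hb₁ : ∀ a b, |b| ≤ R → |e₁ a b| ≤ C * (1 + a ^ 2))
    (hb₂ : ∀ a b, |b| ≤ R → |e₂ a b| ≤ C * (|a| + a ^ 2)) :
    Integrable (fun x => e (u.1.val x) (v.1.val x) * u.1.lap x) (volume.restrict Ω) ∧
    Integrable (fun x => e₁ (u.1.val x) (v.1.val x) * gradDot u.1 u.1 x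
      + e₂ (u.1.val x) (v.1.val x) * gradDot v.1 u.1 x) (volume.restrict Ω) ∧
    ∫ x in Ω, e (u.1.val x) (v.1.val x) * u.1.lap x
      = - ∫ x in Ω, (e₁ (u.1.val x) (v.1.val x) * gradDot u.1 u.1 x
          + e₂ (u.1.val x) (v.1.val x) * gradDot v.1 u.1 x) := by
  -- A nonzero measure supplies a point where |v| ≤ R, hence R ≥ 0 and then C ≥ 0.
  rcases eq_or_ne (volume.restrict Ω) 0 with hμ | hμ
  · simp [hμ]
  have hne : (ae (volume.restrict Ω)).NeBot := ae_neBot.2 hμ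
  have hR : 0 ≤ R := by
    obtain ⟨x, hx⟩ := hv.exists
    exact (abs_nonneg _).trans hx
  have hC : 0 ≤ C := by
    have := (abs_nonneg _).trans (hb₁ 0 0 (by simpa using hR))
    simpa using this
  have hc : Continuous fun p : ℝ × ℝ => e p.1 p.2 :=
    continuous_iff_continuousAt.2 fun p => (he p.1 p.2).continuousAt
  have hmeas : ∀ {Ψ : ℝ → ℝ → ℝ}, (Continuous fun p : ℝ × ℝ => Ψ p.1 p.2) →
      AEStronglyMeasurable (fun x => Ψ (u.1.val x) (v.1.val x)) (volume.restrict Ω) :=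
    fun hΨ => hΨ.comp_aestronglyMeasurable
      ((Lp.aestronglyMeasurable u.1.val).prodMk (Lp.aestronglyMeasurable v.1.val))
  have mG := (integrable_gradDot u.1 u.1).aestronglyMeasurable
  have mH := (integrable_gradDot v.1 u.1).aestronglyMeasurable
  have mD := Lp.aestronglyMeasurable u.1.lap
  have iS := integrable_sq_mul_gradDot hΩ u h3
  have iG := integrable_gradDot u.1 u.1
  have iU : Integrable (fun x => u.1.val x * u.1.val x) (volume.restrict Ω) :=
    integrable_mul_L2 _ _
  -- dominating functions
  set D₀ : EuclideanSpace ℝ (Fin d) → ℝ := fun x =>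
    C * (|u.1.val x| * |u.1.lap x| + |u.1.val x| ^ 3 * |u.1.lap x|) with hD₀
  have iD₀ : Integrable D₀ (volume.restrict Ω) := by
    refine (Integrable.add ?_ h3).const_mul C
    exact (integrable_mul_L2 u.1.val u.1.lap).abs.congr
      (Eventually.of_forall fun x => abs_mul _ _)
  set D₁ : EuclideanSpace ℝ (Fin d) → ℝ := fun x =>
    C * (gradDot u.1 u.1 x + u.1.val x ^ 2 * gradDot u.1 u.1 x)
      + C * R * (2 * (u.1.val x * u.1.val x) + gradDot u.1 u.1 x
        + u.1.val x ^ 2 * gradDot u.1 u.1 x) with hD₁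
  have iD₁ : Integrable D₁ (volume.restrict Ω) :=
    ((iG.add iS).const_mul C).add ((((iU.const_mul 2).add iG).add iS).const_mul (C * R))
  have bD₀ : ∀ x a k, |a| ≤ C * (|k| + |k| ^ 3) → |k| ≤ |u.1.val x| →
      ‖a * u.1.lap x‖ ≤ D₀ x := by
    intro x a k h1 h2
    rw [norm_mul, Real.norm_eq_abs, Real.norm_eq_abs]
    calc |a| * |u.1.lap x| ≤ C * (|u.1.val x| + |u.1.val x| ^ 3) * |u.1.lap x| := by
          refine mul_le_mul_of_nonneg_right (h1.trans ?_) (abs_nonneg _)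
          gcongr
      _ = D₀ x := by rw [hD₀]; ring
  have bD₁ : ∀ x a b k s t, |a| ≤ C * (1 + k ^ 2) → |b| ≤ C * (|k| + k ^ 2) →
      |k| ≤ |u.1.val x| → |s| ≤ 1 → |t| ≤ 1 → √(∑ i, (v.1.grad i x) ^ 2) ≤ R →
      ‖a * s * gradDot u.1 u.1 x + b * t * gradDot v.1 u.1 x‖ ≤ D₁ x := by
    intro x a b k s t h1 h2 h3 hs ht h4
    have hk : k ^ 2 ≤ u.1.val x ^ 2 := sq_le_sq.2 h3
    set G : ℝ := gradDot u.1 u.1 x with hG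
    have hG0 : 0 ≤ G := gradDot_self_nonneg u.1 x
    set w : ℝ := u.1.val x
    have hH := abs_gradDot_le (u := u.1) h4
    rw [← hG] at hH
    have hsq : √G ^ 2 = G := Real.sq_sqrt hG0
    have hs0 : 0 ≤ √G := Real.sqrt_nonneg G
    have f1 : ‖a * s * G‖ ≤ C * (G + w ^ 2 * G) := by
      rw [norm_mul, norm_mul, Real.norm_of_nonneg hG0, Real.norm_eq_abs, Real.norm_eq_abs]
      calc |a| * |s| * G ≤ C * (1 + k ^ 2) * 1 * G :=
            mul_le_mul_of_nonneg_right (mul_le_mul h1 hs (abs_nonneg _) (by positivity)) hG0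
        _ ≤ C * (1 + w ^ 2) * 1 * G := by gcongr
        _ = C * (G + w ^ 2 * G) := by ring
    have f2 : ‖b * t * gradDot v.1 u.1 x‖ ≤ C * R * (2 * (w * w) + G + w ^ 2 * G) := by
      rw [norm_mul, norm_mul, Real.norm_eq_abs, Real.norm_eq_abs, Real.norm_eq_abs]
      -- `g1` and `g2` split |w|·√G and w²·√G into pieces known to be integrable: w², G and w²G.
      have g1 : |w| * √G ≤ w ^ 2 + G := by
        nlinarith [sq_nonneg (|w| - √G), sq_abs w, sq_nonneg w]
      have g2 : w ^ 2 * √G ≤ w ^ 2 + w ^ 2 * G := by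
        have : √G ≤ 1 + G := by nlinarith [sq_nonneg (√G - 1)]
        calc w ^ 2 * √G ≤ w ^ 2 * (1 + G) := mul_le_mul_of_nonneg_left this (sq_nonneg w)
          _ = w ^ 2 + w ^ 2 * G := by ring
      calc |b| * |t| * |gradDot v.1 u.1 x|
          ≤ C * (|k| + k ^ 2) * 1 * (R * √G) :=
            mul_le_mul (mul_le_mul h2 ht (abs_nonneg _) (by positivity)) hH (abs_nonneg _)
              (by positivity)
        _ ≤ C * (|w| + w ^ 2) * 1 * (R * √G) := by gcongr
        _ = C * R * (|w| * √G + w ^ 2 * √G) := by ring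
        _ ≤ C * R * ((w ^ 2 + G) + (w ^ 2 + w ^ 2 * G)) := by gcongr
        _ = C * R * (2 * (w * w) + G + w ^ 2 * G) := by ring
    exact (norm_add_le _ _).trans (add_le_add f1 f2)
  -- the truncated identity
  have htrunc : ∀ n : ℕ, ∫ x in Ω, e (trunc n (u.1.val x)) (trunc n (v.1.val x)) * u.1.lap x
      = - ∫ x in Ω, (e₁ (trunc n (u.1.val x)) (trunc n (v.1.val x)) * truncDeriv n (u.1.val x)
            * gradDot u.1 u.1 x
          + e₂ (trunc n (u.1.val x)) (trunc n (v.1.val x)) * truncDeriv n (v.1.val x)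
            * gradDot v.1 u.1 x) := by
    intro n
    set L : ℝ := ((n : ℝ) + 1) * (Real.pi / 2) with hL
    have hbound : ∀ {Ψ : ℝ → ℝ → ℝ}, (Continuous fun p : ℝ × ℝ => Ψ p.1 p.2) →
        ∃ B, ∀ a b, |Ψ (trunc n a) (trunc n b)| ≤ B := by
      intro Ψ hΨ
      obtain ⟨B, hB⟩ := ((isCompact_Icc (a := -L) (b := L)).prod
        (isCompact_Icc (a := -L) (b := L))).exists_bound_of_continuousOn hΨ.continuousOn
      exact ⟨B, fun a b => hB (trunc n a, trunc n b)
        ⟨abs_le.1 (abs_trunc_le n a), abs_le.1 (abs_trunc_le n b)⟩⟩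
    obtain ⟨B, hB⟩ := hbound hc
    obtain ⟨B₁, hB₁⟩ := hbound hc₁
    obtain ⟨B₂, hB₂⟩ := hbound hc₂
    have hT : Continuous fun p : ℝ × ℝ => (trunc n p.1, trunc n p.2) :=
      ((continuous_trunc n).comp continuous_fst).prodMk ((continuous_trunc n).comp continuous_snd)
    refine green_of_bounded hΩ u v (Φ := fun a b => e (trunc n a) (trunc n b))
      (Φ₁ := fun a b => e₁ (trunc n a) (trunc n b) * truncDeriv n a)
      (Φ₂ := fun a b => e₂ (trunc n a) (trunc n b) * truncDeriv n b)
      (C := max B (max B₁ B₂)) (fun a b => ?_)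
      ((hc₁.comp hT).mul ((continuous_truncDeriv n).comp continuous_fst))
      ((hc₂.comp hT).mul ((continuous_truncDeriv n).comp continuous_snd))
      (fun a b => (hB a b).trans (le_max_left _ _)) (fun a b => ?_) (fun a b => ?_)
    · have h1 := (hasDerivAt_trunc n a).hasFDerivAt.comp (a, b)
        (hasFDerivAt_fst (𝕜 := ℝ) (E := ℝ) (F := ℝ) (p := (a, b)))
      have h2 := (hasDerivAt_trunc n b).hasFDerivAt.comp (a, b)
        (hasFDerivAt_snd (𝕜 := ℝ) (E := ℝ) (F := ℝ) (p := (a, b)))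
      have h3 := (he (trunc n a) (trunc n b)).comp (a, b) (h1.prodMk h2)
      refine h3.congr_fderiv ?_
      ext <;> simp
    · rw [abs_mul]
      calc |e₁ (trunc n a) (trunc n b)| * |truncDeriv n a|
          ≤ |e₁ (trunc n a) (trunc n b)| * 1 :=
            mul_le_mul_of_nonneg_left (abs_truncDeriv_le_one n a) (abs_nonneg _)
        _ ≤ max B (max B₁ B₂) := by
            rw [mul_one]
            exact (hB₁ a b).trans ((le_max_left _ _).trans (le_max_right _ _))
    · rw [abs_mul]
      calc |e₂ (trunc n a) (trunc n b)| * |truncDeriv n b|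
          ≤ |e₂ (trunc n a) (trunc n b)| * 1 :=
            mul_le_mul_of_nonneg_left (abs_truncDeriv_le_one n b) (abs_nonneg _)
        _ ≤ max B (max B₁ B₂) := by
            rw [mul_one]
            exact (hB₂ a b).trans ((le_max_right _ _).trans (le_max_right _ _))
  have hTn : ∀ n : ℕ, Continuous fun p : ℝ × ℝ => (trunc n p.1, trunc n p.2) := fun n =>
    ((continuous_trunc n).comp continuous_fst).prodMk ((continuous_trunc n).comp continuous_snd)
  have hlim : ∀ {Ψ : ℝ → ℝ → ℝ}, (Continuous fun p : ℝ × ℝ => Ψ p.1 p.2) → ∀ a b,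
      Tendsto (fun n => Ψ (trunc n a) (trunc n b)) atTop (𝓝 (Ψ a b)) := fun hΨ a b =>
    (hΨ.tendsto (a, b)).comp ((tendsto_trunc a).prodMk_nhds (tendsto_trunc b))
  have t0 : Tendsto (fun n => ∫ x in Ω, e (trunc n (u.1.val x)) (trunc n (v.1.val x)) * u.1.lap x)
      atTop (𝓝 (∫ x in Ω, e (u.1.val x) (v.1.val x) * u.1.lap x)) := by
    refine tendsto_integral_of_dominated_convergence D₀
      (fun n => (hmeas (Ψ := fun a b => e (trunc n a) (trunc n b))
        (hc.comp (hTn n))).mul mD) iD₀ (fun n => ?_)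
      (Eventually.of_forall fun x => (hlim hc _ _).mul_const _)
    filter_upwards [hv] with x hx
    exact bD₀ x _ _ (hb _ _ ((abs_trunc_le_abs n _).trans hx)) (abs_trunc_le_abs n _)
  have t1 : Tendsto (fun n => ∫ x in Ω,
      (e₁ (trunc n (u.1.val x)) (trunc n (v.1.val x)) * truncDeriv n (u.1.val x)
            * gradDot u.1 u.1 x
          + e₂ (trunc n (u.1.val x)) (trunc n (v.1.val x)) * truncDeriv n (v.1.val x)
            * gradDot v.1 u.1 x)) atTop
      (𝓝 (∫ x in Ω, (e₁ (u.1.val x) (v.1.val x) * gradDot u.1 u.1 x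
          + e₂ (u.1.val x) (v.1.val x) * gradDot v.1 u.1 x))) := by
    refine tendsto_integral_of_dominated_convergence D₁ (fun n => ?_) iD₁ (fun n => ?_)
      (Eventually.of_forall fun x => ?_)
    · exact (((hmeas (Ψ := fun a b => e₁ (trunc n a) (trunc n b))
        (hc₁.comp (hTn n))).mul ((continuous_truncDeriv n).comp_aestronglyMeasurable
        (Lp.aestronglyMeasurable u.1.val))).mul mG).add
        (((hmeas (Ψ := fun a b => e₂ (trunc n a) (trunc n b))
        (hc₂.comp (hTn n))).mul ((continuous_truncDeriv n).comp_aestronglyMeasurable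
        (Lp.aestronglyMeasurable v.1.val))).mul mH)
    · filter_upwards [hv, hv'] with x hx hx'
      have hT := (abs_trunc_le_abs n (v.1.val x)).trans hx
      exact bD₁ x _ _ _ _ _ (hb₁ _ _ hT) (hb₂ _ _ hT) (abs_trunc_le_abs n _)
        (abs_truncDeriv_le_one n _) (abs_truncDeriv_le_one n _) hx'
    · have s1 := ((hlim hc₁ (u.1.val x) (v.1.val x)).mul
        (tendsto_truncDeriv (u.1.val x))).mul_const (gradDot u.1 u.1 x)
      have s2 := ((hlim hc₂ (u.1.val x) (v.1.val x)).mul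
        (tendsto_truncDeriv (v.1.val x))).mul_const (gradDot v.1 u.1 x)
      simpa using s1.add s2
  refine ⟨?_, ?_, tendsto_nhds_unique t0 (t1.neg.congr fun n => (htrunc n).symm)⟩
  · refine iD₀.mono' ((hmeas hc).mul mD) ?_
    filter_upwards [hv] with x hx
    exact bD₀ x _ _ (hb _ _ hx) le_rfl
  · refine iD₁.mono' (((hmeas hc₁).mul mG).add ((hmeas hc₂).mul mH)) ?_
    filter_upwards [hv, hv'] with x hx hx'
    have := bD₁ x _ _ _ 1 1 (hb₁ _ _ hx) (hb₂ _ _ hx) le_rfl (by simp) (by simp) hx'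
    simpa only [mul_one] using this

end CahnHilliard
end

/-! ### The nonlinear estimate and the energy step -/

noncomputable section
namespace CahnHilliard
variable {d : ℕ} {Ω : Set (EuclideanSpace ℝ (Fin d))}

open ContinuousLinearMap in
lemma hasFDerivAt_calib (a b c : ℝ) {q : ℝ} (hq : 0 < q) (z ρ : ℝ) :
    HasFDerivAt (fun p : ℝ × ℝ => calib a b c q p.1 p.2)
      (calibZ a b c q z ρ • fst ℝ ℝ ℝ + calibR b z ρ • snd ℝ ℝ ℝ) (z, ρ) := by
  have hz : HasFDerivAt (fun p : ℝ × ℝ => p.1) (fst ℝ ℝ ℝ) (z, ρ) := hasFDerivAt_fst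
  have hr : HasFDerivAt (fun p : ℝ × ℝ => p.2) (snd ℝ ℝ ℝ) (z, ρ) := hasFDerivAt_snd
  have hs : HasDerivAt (fun t : ℝ => t * (t ^ 2 / (q + t ^ 2)))
      (z ^ 2 * (3 * q + z ^ 2) / (q + z ^ 2) ^ 2) z := by
    have h1 := (hasDerivAt_id z).mul (((hasDerivAt_id z).pow 2).div
      (((hasDerivAt_id z).pow 2).const_add q) (by simp only [id, Pi.pow_apply]; positivity))
    refine h1.congr_deriv ?_
    simp only [id, Pi.pow_apply, Pi.div_apply]
    field_simp
    ring
  have hs' := hs.hasFDerivAt.comp (z, ρ) hz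
  have h := (((((hr.add hz).pow 3).sub (hr.pow 3)).const_mul 2).add
    ((hz.const_mul a).add ((hz.mul (hr.pow 2)).const_mul b))).add (hs'.const_mul c)
  refine (h.congr_fderiv ?_).congr_of_eventuallyEq (Eventually.of_forall fun p => ?_)
  · ext <;> simp [calibZ, calibR] <;> ring
  · simp [calib]; ring

lemma continuous_calibZ (a b c : ℝ) {q : ℝ} (hq : 0 < q) :
    Continuous fun p : ℝ × ℝ => calibZ a b c q p.1 p.2 := by
  unfold calibZ
  have : Continuous fun p : ℝ × ℝ => p.1 ^ 2 * (3 * q + p.1 ^ 2) / (q + p.1 ^ 2) ^ 2 :=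
    Continuous.div (by fun_prop) (by fun_prop) fun p => by positivity
  fun_prop

lemma continuous_calibR (b : ℝ) : Continuous fun p : ℝ × ℝ => calibR b p.1 p.2 := by
  unfold calibR; fun_prop

/-- Supplies the growth hypotheses of `green_of_cubic_growth`; the rational factors in z are bounded
by 3, so they do not affect the growth. -/
lemma calib_growth (a b c : ℝ) {q R : ℝ} (hq : 0 < q) (hR : 0 ≤ R) :
    ∃ C, ∀ z ρ : ℝ, |ρ| ≤ R → |calib a b c q z ρ| ≤ C * (|z| + |z| ^ 3) ∧
      |calibZ a b c q z ρ| ≤ C * (1 + z ^ 2) ∧ |calibR b z ρ| ≤ C * (|z| + z ^ 2) := by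
  refine ⟨12 + 12 * R + 12 * R ^ 2 + |a| + 2 * |b| * R + |b| * R ^ 2 + 3 * |c|,
    fun z ρ hρ => ?_⟩
  have hρ2 : ρ ^ 2 ≤ R ^ 2 := sq_le_sq' (abs_le.1 hρ).1 (abs_le.1 hρ).2
  have hz : |z| ^ 2 = z ^ 2 := sq_abs z
  have ha := abs_nonneg a
  have hb := abs_nonneg b
  have hc := abs_nonneg c
  have hz0 := abs_nonneg z
  have hbR : 0 ≤ |b| * R := by positivity
  have hbR2 : 0 ≤ |b| * R ^ 2 := by positivity
  have hD : ∀ s : ℝ, 0 ≤ s → s ≤ 3 → |a + b * ρ ^ 2 + c * s| ≤ |a| + |b| * R ^ 2 + 3 * |c| := by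
    intro s h0 h1
    refine (abs_add_three _ _ _).trans ?_
    rw [abs_mul, abs_mul, abs_of_nonneg h0, abs_of_nonneg (sq_nonneg ρ)]
    have := mul_le_mul_of_nonneg_left hρ2 hb
    have := mul_le_mul_of_nonneg_left h1 hc
    linarith
  refine ⟨?_, ?_, ?_⟩
  · have hs0 : 0 ≤ z ^ 2 / (q + z ^ 2) := by positivity
    have hs1 : z ^ 2 / (q + z ^ 2) ≤ 3 := by
      rw [div_le_iff₀ (by positivity)]; nlinarith [sq_nonneg z]
    have h1 := hD _ hs0 hs1
    have e : calib a b c q z ρ = z * (6 * ρ ^ 2 + 6 * ρ * z + 2 * z ^ 2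
        + (a + b * ρ ^ 2 + c * (z ^ 2 / (q + z ^ 2)))) := by unfold calib; ring
    have h2 : |6 * ρ ^ 2 + 6 * ρ * z + 2 * z ^ 2| ≤ 6 * R ^ 2 + 6 * R * |z| + 2 * |z| ^ 2 := by
      refine (abs_add_three _ _ _).trans ?_
      rw [abs_mul, abs_mul, abs_mul, abs_mul, abs_pow, abs_pow, sq_abs, hz]
      norm_num
      gcongr
    rw [e, abs_mul]
    have h3 := (abs_add_le (6 * ρ ^ 2 + 6 * ρ * z + 2 * z ^ 2)
      (a + b * ρ ^ 2 + c * (z ^ 2 / (q + z ^ 2)))).trans (add_le_add h2 h1)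
    have h4 : |z| ≤ 1 + |z| ^ 2 := by nlinarith [sq_nonneg (|z| - 1)]
    have h5 : 6 * R ^ 2 + 6 * R * |z| + 2 * |z| ^ 2 + (|a| + |b| * R ^ 2 + 3 * |c|)
        ≤ (12 + 12 * R + 12 * R ^ 2 + |a| + 2 * |b| * R + |b| * R ^ 2 + 3 * |c|)
          * (1 + |z| ^ 2) := by
      have g1 := mul_le_mul_of_nonneg_left h4 hR
      have g2 : 0 ≤ (|a| + 2 * |b| * R + |b| * R ^ 2 + 3 * |c| + 12 * R ^ 2 + 6 * R) * |z| ^ 2 := by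
        positivity
      nlinarith
    calc |z| * _ ≤ |z| * ((12 + 12 * R + 12 * R ^ 2 + |a| + 2 * |b| * R + |b| * R ^ 2 + 3 * |c|)
          * (1 + |z| ^ 2)) := mul_le_mul_of_nonneg_left (h3.trans h5) hz0
      _ = _ := by ring
  · have hs0 : 0 ≤ z ^ 2 * (3 * q + z ^ 2) / (q + z ^ 2) ^ 2 := by positivity
    have hs1 : z ^ 2 * (3 * q + z ^ 2) / (q + z ^ 2) ^ 2 ≤ 3 := by
      rw [div_le_iff₀ (by positivity)]; nlinarith [sq_nonneg z, sq_nonneg (z ^ 2), sq_nonneg q,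
        mul_nonneg hq.le (sq_nonneg z)]
    have h1 := hD _ hs0 hs1
    have h2 : |6 * (ρ + z) ^ 2| ≤ 12 * R ^ 2 + 12 * z ^ 2 := by
      rw [abs_of_nonneg (by positivity)]; nlinarith [sq_nonneg (ρ - z)]
    have h3 := (abs_add_le (6 * (ρ + z) ^ 2) _).trans (add_le_add h2 h1)
    have g2 : 0 ≤ (|a| + 2 * |b| * R + |b| * R ^ 2 + 3 * |c| + 12 * R ^ 2 + 12 * R) * z ^ 2 := by
      positivity
    unfold calibZ
    refine h3.trans ?_
    nlinarith
  · have e : calibR b z ρ = z * ((12 * ρ + 2 * b * ρ) + 6 * z) := by unfold calibR; ring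
    have h1 : |(12 * ρ + 2 * b * ρ) + 6 * z| ≤ 12 * R + 2 * |b| * R + 6 * |z| := by
      refine (abs_add_three _ _ _).trans ?_
      rw [abs_mul, abs_mul, abs_mul, abs_mul]
      norm_num
      gcongr
    rw [e, abs_mul, ← hz]
    have g1 : 0 ≤ |z| * (|a| + |b| * R ^ 2 + 3 * |c| + 12 * R ^ 2 + 12) := by positivity
    have g2 : 0 ≤ |z| ^ 2 * (|a| + |b| * R ^ 2 + 3 * |c| + 12 * R ^ 2 + 6 + 12 * R
        + 2 * |b| * R) := by positivity
    have := mul_le_mul_of_nonneg_left h1 hz0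
    nlinarith

lemma ae_abs_le_of_w1InftyNorm_le {v : Jet Ω} {R : ℝ} (hR : 0 ≤ R)
    (h : w1InftyNorm v ≤ ENNReal.ofReal R) :
    (∀ᵐ x ∂(volume.restrict Ω), |v.val x| ≤ R) ∧
      ∀ᵐ x ∂(volume.restrict Ω), √(∑ i, (v.grad i x) ^ 2) ≤ R := by
  have key : ∀ f : EuclideanSpace ℝ (Fin d) → ℝ,
      eLpNorm f ∞ (volume.restrict Ω) ≤ ENNReal.ofReal R → ∀ᵐ x ∂(volume.restrict Ω), |f x| ≤ R := by
    intro f hf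
    rw [eLpNorm_exponent_top] at hf
    filter_upwards [enorm_ae_le_eLpNormEssSup f (volume.restrict Ω)] with x hx
    have h1 := hx.trans hf
    rwa [Real.enorm_eq_ofReal_abs, ENNReal.ofReal_le_ofReal_iff hR] at h1
  refine ⟨key _ ((le_max_left _ _).trans h), ?_⟩
  filter_upwards [key _ ((le_max_right _ _).trans h)] with x hx
  exact (le_abs_self _).trans hx

/-- The nonlinear term is controlled by `ν ‖Δu‖² + (C* - 1) ‖u‖²`. -/
lemma nonlinear_term_le [IsFiniteMeasure (volume.restrict Ω)] (hΩ : IsOpen Ω) {ν R : ℝ}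
    (hν : 0 < ν) (hR : 0 ≤ R) (y v : H2n Ω) (hv : w1InftyNorm v.1 ≤ ENNReal.ofReal R)
    (hy : Integrable (fun x => phi (y.1.val x) * (y - v).1.lap x) (volume.restrict Ω))
    (hvi : Integrable (fun x => phi (v.1.val x) * (y - v).1.lap x) (volume.restrict Ω)) :
    2 * ((∫ x in Ω, phi (y.1.val x) * (y - v).1.lap x)
        - ∫ x in Ω, phi (v.1.val x) * (y - v).1.lap x)
      ≤ ν * ‖(y - v).1.lap‖ ^ 2 + (Cstar ν R - 1) * ‖(y - v).1.val‖ ^ 2 := by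
  obtain ⟨a, b, c, q, hq, hcal⟩ := exists_calibration hν hR
  obtain ⟨C, hC⟩ := calib_growth a b c hq hR
  obtain ⟨hv1, hv2⟩ := ae_abs_le_of_w1InftyNorm_le hR hv
  set u : H2n Ω := y - v with hu
  have hsum : ∀ᵐ x ∂(volume.restrict Ω), y.1.val x = v.1.val x + u.1.val x := by
    have : u.1.val = y.1.val - v.1.val := rfl
    filter_upwards [Lp.coeFn_sub y.1.val v.1.val] with x hx
    rw [this, hx, Pi.sub_apply]; ring
  set g : EuclideanSpace ℝ (Fin d) → ℝ := fun x =>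
    phi (y.1.val x) * u.1.lap x - phi (v.1.val x) * u.1.lap x with hg
  have ig : Integrable g (volume.restrict Ω) := hy.sub hvi
  have iul : Integrable (fun x => u.1.val x * u.1.lap x) (volume.restrict Ω) :=
    integrable_mul_L2 _ _
  -- φ(yr + z) - φ(yr) has leading term z³, and the lower-order terms have coefficients bounded
  -- through R. The quadratic one is absorbed via |z|(|z| - 3R)² ≥ 0, so |u|³|Δu| is dominated by
  -- the given integrable difference and |uΔu|.
  have h3 : Integrable (fun x => |u.1.val x| ^ 3 * |u.1.lap x|) (volume.restrict Ω) := by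
    refine ((ig.abs.const_mul 2).add (iul.abs.const_mul (9 * R ^ 2 + 2 * (3 * R ^ 2 + 1)))).mono'
      ?_ ?_
    · exact ((continuous_abs.pow 3).comp_aestronglyMeasurable
        (Lp.aestronglyMeasurable u.1.val)).mul
        (continuous_abs.comp_aestronglyMeasurable (Lp.aestronglyMeasurable u.1.lap))
    · filter_upwards [hv1, hsum] with x hx hxs
      set z : ℝ := u.1.val x
      set ρ : ℝ := v.1.val x
      set D : ℝ := u.1.lap x
      have hgx : g x = (z ^ 3 + 3 * ρ * z ^ 2 + (3 * ρ ^ 2 - 1) * z) * D := by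
        simp only [hg, phi, hxs]; ring
      have hz : |z| ^ 3 ≤ 2 * |z ^ 3 + 3 * ρ * z ^ 2 + (3 * ρ ^ 2 - 1) * z|
          + (9 * R ^ 2 + 2 * (3 * R ^ 2 + 1)) * |z| := by
        have hρ2 : ρ ^ 2 ≤ R ^ 2 := sq_le_sq' (abs_le.1 hx).1 (abs_le.1 hx).2
        have t1 : |z| ^ 3 ≤ |z ^ 3 + 3 * ρ * z ^ 2 + (3 * ρ ^ 2 - 1) * z|
            + 3 * R * |z| ^ 2 + (3 * R ^ 2 + 1) * |z| := by
          have e : z ^ 3 = (z ^ 3 + 3 * ρ * z ^ 2 + (3 * ρ ^ 2 - 1) * z)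
            + (-(3 * ρ * z ^ 2)) + (-((3 * ρ ^ 2 - 1) * z)) := by ring
          have s1 := abs_add_three (z ^ 3 + 3 * ρ * z ^ 2 + (3 * ρ ^ 2 - 1) * z)
            (-(3 * ρ * z ^ 2)) (-((3 * ρ ^ 2 - 1) * z))
          rw [← e, abs_pow, abs_neg, abs_neg] at s1
          have s2 : |3 * ρ * z ^ 2| ≤ 3 * R * |z| ^ 2 := by
            rw [abs_mul, abs_mul, abs_pow, abs_of_pos (by norm_num : (0 : ℝ) < 3)]
            gcongr
          have s3 : |(3 * ρ ^ 2 - 1) * z| ≤ (3 * R ^ 2 + 1) * |z| := by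
            rw [abs_mul]
            refine mul_le_mul_of_nonneg_right ?_ (abs_nonneg _)
            rw [abs_le]
            constructor <;> nlinarith [sq_nonneg ρ]
          linarith
        have t2 : 3 * R * |z| ^ 2 ≤ 1 / 2 * |z| ^ 3 + 9 / 2 * R ^ 2 * |z| := by
          have := mul_nonneg (abs_nonneg z) (sq_nonneg (|z| - 3 * R))
          nlinarith
        linarith
      simp only [norm_mul, norm_pow, Real.norm_eq_abs, abs_abs, Pi.add_apply]
      rw [hgx, abs_mul, abs_mul]
      calc |z| ^ 3 * |D| ≤ _ := mul_le_mul_of_nonneg_right hz (abs_nonneg D)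
        _ = _ := by ring
  obtain ⟨ie, ie', hgreen⟩ := green_of_cubic_growth hΩ u v hv1 hv2 h3
    (hasFDerivAt_calib a b c hq) (continuous_calibZ a b c hq) (continuous_calibR b)
    (fun z ρ h => (hC z ρ h).1) (fun z ρ h => (hC z ρ h).2.1) (fun z ρ h => (hC z ρ h).2.2)
  have iuu : Integrable (fun x => u.1.val x * u.1.val x) (volume.restrict Ω) :=
    integrable_mul_L2 _ _
  have ill : Integrable (fun x => u.1.lap x * u.1.lap x) (volume.restrict Ω) :=
    integrable_mul_L2 _ _
  have hnorm : ∀ f : L2 Ω, ‖f‖ ^ 2 = ∫ x in Ω, f x * f x := fun f => by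
    rw [← real_inner_self_eq_norm_sq, inner_L2_eq]
  rw [← integral_sub hy hvi, hnorm, hnorm, ← integral_const_mul, ← integral_const_mul,
    ← integral_const_mul, ← integral_add (ill.const_mul ν) (iuu.const_mul _)]
  -- Green's formula enters here: the subtracted terms have total integral zero.
  have hsplit : ∫ x in Ω, 2 * g x = ∫ x in Ω,
      ((2 * g x - calib a b c q (u.1.val x) (v.1.val x) * u.1.lap x)
        - (calibZ a b c q (u.1.val x) (v.1.val x) * gradDot u.1 u.1 x
          + calibR b (u.1.val x) (v.1.val x) * gradDot v.1 u.1 x)) := by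
    have i1 : Integrable (fun x => 2 * g x
      - calib a b c q (u.1.val x) (v.1.val x) * u.1.lap x) (volume.restrict Ω) :=
      (ig.const_mul 2).sub ie
    rw [integral_sub i1 ie', integral_sub (ig.const_mul 2) ie, hgreen]
    ring
  change ∫ x in Ω, 2 * g x ≤ _
  rw [hsplit]
  refine integral_mono_ae (((ig.const_mul 2).sub ie).sub ie')
    ((ill.const_mul ν).add (iuu.const_mul _)) ?_
  filter_upwards [hv1, hv2, hsum] with x hx hx' hxs
  set z : ℝ := u.1.val x with hz
  set ρ : ℝ := v.1.val x
  set D : ℝ := u.1.lap x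
  have hp : √(gradDot u.1 u.1 x) ^ 2 = gradDot u.1 u.1 x := Real.sq_sqrt (gradDot_self_nonneg _ _)
  have hpt := hcal z ρ √(gradDot u.1 u.1 x) hx
  rw [hp] at hpt
  have hH := abs_gradDot_le (u := u.1) hx'
  have h1 : -(calibR b z ρ * gradDot v.1 u.1 x) ≤ |calibR b z ρ| * R * √(gradDot u.1 u.1 x) := by
    calc -(calibR b z ρ * gradDot v.1 u.1 x) ≤ |calibR b z ρ * gradDot v.1 u.1 x| := neg_le_abs _
      _ = |calibR b z ρ| * |gradDot v.1 u.1 x| := abs_mul _ _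
      _ ≤ |calibR b z ρ| * (R * √(gradDot u.1 u.1 x)) :=
          mul_le_mul_of_nonneg_left hH (abs_nonneg _)
      _ = _ := by ring
  set f : ℝ := 2 * z + z * (a + b * ρ ^ 2 + c * (z ^ 2 / (q + z ^ 2))) with hf
  -- The cubic parts of φ(y) - φ(yr) and of the calibration cancel.
  have h2 : 2 * g x - calib a b c q z ρ * D = -f * D := by
    simp only [hg, phi, hxs, calib, hf]; ring
  have h4 : -f * D ≤ f ^ 2 / (4 * ν) + ν * (D * D) := by
    have e : f ^ 2 / (4 * ν) + ν * (D * D) - -f * D = (f + 2 * ν * D) ^ 2 / (4 * ν) := by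
      field_simp; ring
    have : 0 ≤ (f + 2 * ν * D) ^ 2 / (4 * ν) := by positivity
    linarith
  have h5 : z * z = z ^ 2 := (sq z).symm
  rw [h2, h5]
  linarith

/-- One step of the implicit Euler scheme. -/
lemma energy_step [IsFiniteMeasure (volume.restrict Ω)] (hΩ : IsOpen Ω) {ν R γ τ : ℝ}
    (hν : 0 < ν) (hR : 0 ≤ R) (hτ : 0 < τ) {F : H2n Ω →L[ℝ] StrongDual ℝ (H2n Ω)}
    (hspec : SpectralCondition ν R γ F) {V : Submodule ℝ (H2n Ω)} {h hr : L2 Ω}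
    {yr' yr y' y : H2n Ω} (hyV : y ∈ V) (hyrV : yr ∈ V)
    (hyr : EulerStep ν τ V yr' yr (fun v => inner ℝ hr v.1.val))
    (hb : w1InftyNorm yr.1 ≤ ENNReal.ofReal R)
    (hy : EulerStep ν τ V y' y (fun v => inner ℝ h v.1.val - F (y - yr) v)) :
    (1 + τ * γ) * ‖y.1.val - yr.1.val‖ ^ 2
      ≤ ‖y'.1.val - yr'.1.val‖ ^ 2 + τ * ‖h - hr‖ ^ 2 := by
  obtain ⟨i1, e1⟩ := hy (y - yr) (V.sub_mem hyV hyrV)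
  obtain ⟨i2, e2⟩ := hyr (y - yr) (V.sub_mem hyV hyrV)
  have hN := nonlinear_term_le hΩ hν hR y yr hb i1 i2
  have hS := hspec (y - yr)
  set u : H2n Ω := y - yr with hu
  have hval : u.1.val = y.1.val - yr.1.val := rfl
  have hlap : u.1.lap = y.1.lap - yr.1.lap := by
    simp [Jet.lap, Jet.hess, hu]
  set z : L2 Ω := u.1.val
  set z' : L2 Ω := y'.1.val - yr'.1.val with hz'
  set I₁ : ℝ := ∫ x in Ω, phi (y.1.val x) * u.1.lap x
  set I₂ : ℝ := ∫ x in Ω, phi (yr.1.val x) * u.1.lap x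
  have hl : (inner ℝ y.1.lap u.1.lap : ℝ) - inner ℝ yr.1.lap u.1.lap = ‖u.1.lap‖ ^ 2 := by
    rw [← inner_sub_left, ← hlap, real_inner_self_eq_norm_sq]
  have hd : (inner ℝ (τ⁻¹ • (y.1.val - y'.1.val)) z : ℝ)
      - inner ℝ (τ⁻¹ • (yr.1.val - yr'.1.val)) z = τ⁻¹ * inner ℝ (z - z') z := by
    rw [← inner_sub_left, ← smul_sub, real_inner_smul_left]
    congr 2
    rw [hval, hz']; abel
  have hh : (inner ℝ h z : ℝ) - inner ℝ hr z = inner ℝ (h - hr) z := (inner_sub_left _ _ _).symm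
  have hE : τ⁻¹ * inner ℝ (z - z') z + ν * ‖u.1.lap‖ ^ 2 - (I₁ - I₂)
      = inner ℝ (h - hr) z - F u u := by
    rw [← hl, ← hd, ← hh]; linarith
  have p1 : ‖z‖ ^ 2 - ‖z'‖ ^ 2 ≤ 2 * inner ℝ (z - z') z := by
    have := norm_sub_sq_real z z'
    rw [inner_sub_left, real_inner_self_eq_norm_sq, real_inner_comm]
    nlinarith [sq_nonneg ‖z - z'‖]
  -- The resulting ‖z‖² is the summand 1 of C*.
  have p2 : 2 * inner ℝ (h - hr) z ≤ ‖h - hr‖ ^ 2 + ‖z‖ ^ 2 := by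
    have := norm_sub_sq_real (h - hr) z
    nlinarith [sq_nonneg ‖h - hr - z‖]
  have hE' : (inner ℝ (z - z') z : ℝ)
      = τ * (inner ℝ (h - hr) z - F u u - ν * ‖u.1.lap‖ ^ 2 + (I₁ - I₂)) := by
    rw [← hE]; field_simp; ring
  have p3 : 2 * (inner ℝ (h - hr) z - F u u - ν * ‖u.1.lap‖ ^ 2 + (I₁ - I₂))
      ≤ ‖h - hr‖ ^ 2 - γ * ‖z‖ ^ 2 := by
    linarith
  have p4 := mul_le_mul_of_nonneg_left p3 hτ.le
  rw [← hval]
  linarith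

/-! ### The discrete rate and Gronwall's argument -/

lemma exp_discreteRate {γ τ : ℝ} (hγ : 0 < γ) (hτ : 0 < τ) (t : ℝ) :
    Real.exp (-(discreteRate γ τ * (t + τ)))
      = (1 + τ * γ)⁻¹ * Real.exp (-(discreteRate γ τ * t)) := by
  have h : discreteRate γ τ * τ = Real.log (1 + τ * γ) := by
    unfold discreteRate; field_simp
  rw [mul_add, h, neg_add, Real.exp_add, Real.exp_neg (Real.log _),
    Real.exp_log (by positivity), mul_comm]

lemma discreteRate_pos {γ τ : ℝ} (hγ : 0 < γ) (hτ : 0 < τ) : 0 < discreteRate γ τ :=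
  div_pos (Real.log_pos (by nlinarith [mul_pos hτ hγ])) hτ

/-- Bernoulli's inequality 1 + τ₀γ ≤ (1 + τγ)^(τ₀/τ), after taking logarithms. -/
lemma discreteRate_antitone {γ τ₀ τ : ℝ} (hγ : 0 < γ) (hτ : 0 < τ) (hle : τ ≤ τ₀) :
    discreteRate γ τ₀ ≤ discreteRate γ τ := by
  have hτ₀ := hτ.trans_le hle
  have h := one_add_mul_self_le_rpow_one_add (s := τ * γ) (p := τ₀ / τ)
    (by nlinarith [mul_pos hτ hγ]) ((one_le_div hτ).2 hle)
  have e : τ₀ / τ * (τ * γ) = τ₀ * γ := by field_simp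
  rw [e] at h
  have h2 := Real.log_le_log (by positivity) h
  rw [Real.log_rpow (by positivity)] at h2
  unfold discreteRate
  rw [div_le_div_iff₀ hτ₀ hτ]
  calc Real.log (1 + τ₀ * γ) * τ ≤ τ₀ / τ * Real.log (1 + τ * γ) * τ :=
        mul_le_mul_of_nonneg_right h2 hτ.le
    _ = Real.log (1 + τ * γ) * τ₀ := by field_simp

/-- The rate is the difference quotient at 0 of τ ↦ log(1 + τγ), whose derivative there is γ. -/
lemma tendsto_discreteRate (γ : ℝ) : Tendsto (discreteRate γ) (𝓝[>] 0) (𝓝 γ) := by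
  have h : HasDerivAt (fun τ : ℝ => Real.log (1 + τ * γ)) γ 0 := by
    have h1 : HasDerivAt (fun τ : ℝ => 1 + τ * γ) γ 0 := by
      simpa using ((hasDerivAt_id (0 : ℝ)).mul_const γ).const_add 1
    simpa using h1.log (by simp)
  have h2 := (hasDerivAt_iff_tendsto_slope_zero.1 h).mono_left
    (nhdsWithin_mono 0 (fun x (hx : 0 < x) => hx.ne'))
  refine h2.congr fun τ => ?_
  simp [discreteRate, div_eq_inv_mul]

/-- The discrete Gronwall argument. -/
lemma gronwall_step {γ τ : ℝ} (hγ : 0 < γ) (hτ : 0 < τ) {a b : ℕ → ℝ} (hb : ∀ n, 0 ≤ b n)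
    (hstep : ∀ n, (1 + τ * γ) * a (n + 1) ≤ a n + τ * b (n + 1)) (n : ℕ) :
    a n ≤ Real.exp (-(discreteRate γ τ * (n * τ))) * a 0
      + ∑ k ∈ Finset.range (n + 1),
          τ * Real.exp (-(discreteRate γ τ * (n * τ - k * τ))) * b k := by
  have hq : 1 ≤ 1 + τ * γ := by nlinarith [mul_pos hτ hγ]
  have hq0 : 0 < 1 + τ * γ := by linarith
  induction n with
  -- The summand k = 0 is not produced by the recursion; it is a nonnegative surplus.
  | zero =>
    have := mul_nonneg hτ.le (hb 0)
    simpa using this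
  | succ n ih =>
    have h1 : a (n + 1) ≤ (1 + τ * γ)⁻¹ * (a n + τ * b (n + 1)) := by
      rw [← div_eq_inv_mul, le_div_iff₀ hq0, mul_comm]; exact hstep n
    -- The new forcing term carries a factor (1 + τγ)⁻¹, discarded because the summand k = n + 1 has
    -- weight τ only.
    have h2 : (1 + τ * γ)⁻¹ * (τ * b (n + 1)) ≤ τ * b (n + 1) :=
      mul_le_of_le_one_left (mul_nonneg hτ.le (hb _)) (inv_le_one_of_one_le₀ hq)
    have h3 := mul_le_mul_of_nonneg_left ih (inv_nonneg.2 hq0.le)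
    rw [Finset.sum_range_succ]
    have e1 : Real.exp (-(discreteRate γ τ * (((n + 1 : ℕ) : ℝ) * τ)))
        = (1 + τ * γ)⁻¹ * Real.exp (-(discreteRate γ τ * (n * τ))) := by
      rw [← exp_discreteRate hγ hτ]; push_cast; ring_nf
    have e2 : ∀ k : ℕ, Real.exp (-(discreteRate γ τ * (((n + 1 : ℕ) : ℝ) * τ - k * τ)))
        = (1 + τ * γ)⁻¹ * Real.exp (-(discreteRate γ τ * (n * τ - k * τ))) := by
      intro k
      rw [← exp_discreteRate hγ hτ]; push_cast; ring_nf
    have e3 : ∑ k ∈ Finset.range (n + 1),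
          τ * Real.exp (-(discreteRate γ τ * (((n + 1 : ℕ) : ℝ) * τ - k * τ))) * b k
        = (1 + τ * γ)⁻¹ * ∑ k ∈ Finset.range (n + 1),
          τ * Real.exp (-(discreteRate γ τ * (n * τ - k * τ))) * b k := by
      rw [Finset.mul_sum]
      exact Finset.sum_congr rfl fun k _ => by rw [e2]; ring
    rw [e1, e3, sub_self, mul_zero, neg_zero, Real.exp_zero, mul_one]
    linarith

end CahnHilliard
end

theorem mainTheorem2 {d : ℕ} (hd : d ≤ 3) (Ω : Set (EuclideanSpace ℝ (Fin d)))
    (hΩo : IsOpen Ω) (hΩb : Bornology.IsBounded Ω) (hΩc : Convex ℝ Ω) (hΩn : Ω.Nonempty)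
    (ν R γ : ℝ) (hν : 0 < ν) (hR : 0 ≤ R) (hγ : 0 < γ)
    (F : CahnHilliard.H2n Ω →L[ℝ] StrongDual ℝ (CahnHilliard.H2n Ω))
    (hF : ∀ z, 0 ≤ F z z)
    (hspec : CahnHilliard.SpectralCondition ν R γ F) :
    -- the stability estimate, for every discretisation and every discrete solution
    (∀ (τ : ℝ) (_ : 0 < τ) (V : Submodule ℝ (CahnHilliard.H2n Ω)) (_ : FiniteDimensional ℝ V)
        (h hr : ℕ → CahnHilliard.L2 Ω) (yr y : ℕ → CahnHilliard.H2n Ω),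
      CahnHilliard.IsDiscreteTarget ν τ V hr yr →
      (∀ n, CahnHilliard.w1InftyNorm (yr n).1 ≤ ENNReal.ofReal R) →
      CahnHilliard.IsDiscreteSolution ν τ F V yr h y →
      (∀ n : ℕ,
        ‖(y n).1.val - (yr n).1.val‖ ^ 2 ≤
          Real.exp (-(CahnHilliard.discreteRate γ τ * (n * τ))) *
              ‖(y 0).1.val - (yr 0).1.val‖ ^ 2
            + ∑ k ∈ Finset.range (n + 1),
                τ * Real.exp (-(CahnHilliard.discreteRate γ τ * (n * τ - k * τ))) *
                  ‖h k - hr k‖ ^ 2) ∧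
      -- exponential stabilisation when the two right hand sides agree
      ((∀ n, 1 ≤ n → h n = hr n) → ∀ n : ℕ,
        ‖(y n).1.val - (yr n).1.val‖ ^ 2 ≤
          Real.exp (-(CahnHilliard.discreteRate γ τ * (n * τ))) *
              ‖(y 0).1.val - (yr 0).1.val‖ ^ 2)) ∧
    -- uniformity of the rate in the discretisation parameters
    (∀ τ, 0 < τ → 0 < CahnHilliard.discreteRate γ τ) ∧
    (∀ τ₀ τ, 0 < τ → τ ≤ τ₀ →
      CahnHilliard.discreteRate γ τ₀ ≤ CahnHilliard.discreteRate γ τ) ∧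
    Tendsto (CahnHilliard.discreteRate γ) (𝓝[>] 0) (𝓝 γ) := by
  have : IsFiniteMeasure (volume.restrict Ω) :=
    isFiniteMeasure_restrict.2 hΩb.measure_lt_top.ne
  refine ⟨fun τ hτ V _ h hr yr y hyr hb hy => ?_, fun τ hτ => CahnHilliard.discreteRate_pos hγ hτ,
    fun τ₀ τ hτ hle => CahnHilliard.discreteRate_antitone hγ hτ hle,
    CahnHilliard.tendsto_discreteRate γ⟩
  have hstep : ∀ n, (1 + τ * γ) * ‖(y (n + 1)).1.val - (yr (n + 1)).1.val‖ ^ 2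
      ≤ ‖(y n).1.val - (yr n).1.val‖ ^ 2 + τ * ‖h (n + 1) - hr (n + 1)‖ ^ 2 := fun n =>
    CahnHilliard.energy_step hΩo hν hR hτ hspec (hy.1 _) (hyr.1 _) (hyr.2 n) (hb _) (hy.2 n)
  refine ⟨CahnHilliard.gronwall_step hγ hτ (a := fun n => ‖(y n).1.val - (yr n).1.val‖ ^ 2)
    (b := fun n => ‖h n - hr n‖ ^ 2) (fun n => sq_nonneg _) hstep, fun heq n => ?_⟩
  -- Gronwall is rerun with zero forcing: the right-hand sides need not agree at n = 0, so the k = 0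
  -- summand of the first estimate might not vanish.
  have hgr := CahnHilliard.gronwall_step hγ hτ (a := fun n => ‖(y n).1.val - (yr n).1.val‖ ^ 2)
    (b := fun _ => 0) (fun _ => le_rfl) (fun n => ?_) n
  · simpa using hgr
  · have := hstep n
    rw [heq (n + 1) (by omega)] at this
    simpa using this
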